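/- Let $\gamma>-1$, let $\mathbb D=\{z\in\mathbb C:|z|<1\}$, and let $L^{2,\gamma}(\mathbb D)=L^2(\mathbb D,d\mu_\gamma)$ with $d\mu_\gamma(z)=(1-|z|^2)^\gamma\,dx\,dy$. For $n\ge 0$ let $\mathbf A^{2,\gamma}_n(\mathbb D)=\{F\in L^{2,\gamma}(\mathbb D):\partial_{\bar z}^{\,n+1}F=0\}$ be the weighted poly-Bergman space of square integrable polyanalytic functions of order $n+1$, where $\partial_z=\tfrac12(\partial_x-i\partial_y)$ and $\partial_{\bar z}=\tfrac12(\partial_x+i\partial_y)$. Define the true weighted poly-Bergman spaces by $\mathcal A^{2,\gamma}_0(\mathbb D)=\mathbf A^{2,\gamma}_0(\mathbb D)$ and $\mathcal A^{2,\gamma}_n(\mathbb D)=\mathbf A^{2,\gamma}_n(\mathbb D)\ominus\mathbf A^{2,\gamma}_{n-1}(\mathbb D)$ for $n\ge1$. The disc polynomials are $$\mathcal R^\gamma_{m,n}(z,\bar z)=\frac{z^m\bar z^n}{|z|^{2\min(m,n)}}\,P^{(\gamma,|m-n|)}_{\min(m,n)}(2|z|^2-1),\qquad m,n\ge0,$$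 (with the quotient read as $z^{m-\min(m,n)}\bar z^{\,n-\min(m,n)}$), where $P^{(\alpha,\beta)}_k$ are the Jacobi polynomials normalized by $P^{(\alpha,\beta)}_k(1)=1$. Write $(a)_k=a(a+1)\cdots(a+k-1)$ and ${}_2F_1(a,b;c;x)=\sum_{j\ge0}\frac{(a)_j(b)_j}{(c)_j}\frac{x^j}{j!}$. Then: (i) For every $n\ge0$ the functions $\mathcal R^\gamma_{m,n}$, $m=0,1,2,\dots$, form an orthogonal basis of $\mathcal A^{2,\gamma}_n(\mathbb D)$. (ii) The spaces $\mathcal A^{2,\gamma}_n(\mathbb D)$, $n\ge 0$, are mutually orthogonal reproducing kernel Hilbert spaces (of functions on $\mathbb D$) in $L^{2,\gamma}(\mathbb D)$, and $$L^{2,\gamma}(\mathbb D)=\bigoplus_{n=0}^\infty\mathcal A^{2,\gamma}_n(\mathbb D)\ \text{ (Hilbert sum)},\qquad \mathbf A^{2,\gamma}_n(\mathbb D)=\bigoplus_{k=0}^n\mathcal A^{2,\gamma}_k(\mathbb D)\quad(n\ge0)$$ as orthogonal direct sums. (iii) For every $n\ge0$ the reproducing kernel of $\mathcal A^{2,\gamma}_n(\mathbb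 D)$ is, for $z,w\in\mathbb D$, $$K^\gamma_n(z,w)=\frac{\gamma+n+1}{\pi\,n!\,(\gamma+1)_n}(1-|z|^2)^{-\gamma}(1-|w|^2)^{-\gamma}\,\partial_z^n\partial_{\bar w}^n\Big\{(1-|z|^2)^{\gamma+n}(1-|w|^2)^{\gamma+n}\,{}_2F_1(\gamma+n+2,\gamma+1;\gamma+n+1;z\bar w)\Big\}.$$ -/

import Mathlib

open MeasureTheory
open scoped ComplexConjugate

noncomputable section

namespace PolyBergman

/-- The open unit disc in the complex plane. -/
abbrev disc : Set ℂ := Metric.ball (0 : ℂ) 1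

/-- The Wirtinger derivative `∂_z = (∂_x - i ∂_y) / 2`. -/
def dz (f : ℂ → ℂ) (z : ℂ) : ℂ :=
  (fderiv ℝ f z 1 - Complex.I * fderiv ℝ f z Complex.I) / 2

/-- The Wirtinger derivative `∂_{z̄} = (∂_x + i ∂_y) / 2`. -/
def dzbar (f : ℂ → ℂ) (z : ℂ) : ℂ :=
  (fderiv ℝ f z 1 + Complex.I * fderiv ℝ f z Complex.I) / 2

/-- Polyanalytic functions of order `k` on the unit disc: functions of class `C^k` (in the real
sense) on the disc that solve `∂_{z̄}^k F = 0` there. -/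
def IsPolyanalytic (k : ℕ) (F : ℂ → ℂ) : Prop :=
  ContDiffOn ℝ k F disc ∧ ∀ z ∈ disc, (dzbar^[k] F) z = 0

/-- The weighted measure `(1 - |z|^2)^γ dx dy` on the unit disc. -/
def weight (γ : ℝ) : Measure ℂ :=
  (volume.restrict disc).withDensity fun z => ENNReal.ofReal ((1 - ‖z‖ ^ 2) ^ γ)

/-- The Hilbert space `L^{2,γ}` of the unit disc. -/
abbrev L2 (γ : ℝ) : Type := Lp ℂ 2 (weight γ)

theorem dzbar_congr {F G : ℂ → ℂ} (h : Set.EqOn F G disc) :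
    Set.EqOn (dzbar F) (dzbar G) disc := by
  intro z hz
  have : F =ᶠ[nhds z] G := Filter.eventuallyEq_of_mem (Metric.isOpen_ball.mem_nhds hz) h
  simp only [dzbar, this.fderiv_eq]

theorem dzbar_iterate_congr (k : ℕ) : ∀ {F G : ℂ → ℂ}, Set.EqOn F G disc →
    Set.EqOn (dzbar^[k] F) (dzbar^[k] G) disc := by
  induction k with
  | zero => intro F G h; exact h
  | succ k ih =>
    intro F G h
    simp only [Function.iterate_succ_apply]
    exact ih (dzbar_congr h)

theorem contDiffOn_dzbar {k : ℕ} {F : ℂ → ℂ} (h : ContDiffOn ℝ (k + 1 : ℕ) F disc) :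
    ContDiffOn ℝ k (dzbar F) disc := by
  have h' : ContDiffOn ℝ k (fderiv ℝ F) disc :=
    h.fderiv_of_isOpen Metric.isOpen_ball (by norm_cast)
  unfold dzbar
  exact ((h'.clm_apply contDiffOn_const).add
    (contDiffOn_const.mul (h'.clm_apply contDiffOn_const))).div_const 2

theorem dzbar_iterate_lin (k : ℕ) (a : ℂ) : ∀ {F G : ℂ → ℂ}, ContDiffOn ℝ k F disc →
    ContDiffOn ℝ k G disc →
    Set.EqOn (dzbar^[k] (fun z => a * F z + G z))
      (fun z => a * (dzbar^[k] F) z + (dzbar^[k] G) z) disc := by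
  induction k with
  | zero => intro F G _ _ z _; rfl
  | succ k ih =>
    intro F G hF hG
    have key : Set.EqOn (dzbar (fun z => a * F z + G z))
        (fun z => a * dzbar F z + dzbar G z) disc := by
      intro z hz
      have hn : disc ∈ nhds z := Metric.isOpen_ball.mem_nhds hz
      have dF : DifferentiableAt ℝ F z :=
        (hF.differentiableOn (by simp)).differentiableAt hn
      have dG : DifferentiableAt ℝ G z :=
        (hG.differentiableOn (by simp)).differentiableAt hn
      have e : fderiv ℝ (fun z => a * F z + G z) z = a • fderiv ℝ F z + fderiv ℝ G z :=
        ((dF.hasFDerivAt.const_mul a).add dG.hasFDerivAt).fderiv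
      simp only [dzbar, e, _root_.add_apply, _root_.smul_apply, smul_eq_mul]
      ring
    simp only [Function.iterate_succ_apply]
    exact (dzbar_iterate_congr k key).trans (ih (contDiffOn_dzbar hF) (contDiffOn_dzbar hG))

theorem IsPolyanalytic.lin {k : ℕ} {F G : ℂ → ℂ} (a : ℂ) (hF : IsPolyanalytic k F)
    (hG : IsPolyanalytic k G) : IsPolyanalytic k (fun z => a * F z + G z) := by
  refine ⟨(contDiffOn_const.mul hF.1).add hG.1, fun z hz => ?_⟩
  rw [dzbar_iterate_lin k a hF.1 hG.1 hz]
  simp only [hF.2 z hz, hG.2 z hz, mul_zero, add_zero]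

theorem isPolyanalytic_zero (k : ℕ) : IsPolyanalytic k (fun _ => 0) := by
  refine ⟨contDiffOn_const, fun z hz => ?_⟩
  have h := dzbar_iterate_lin k (-1) (F := fun _ => (0 : ℂ)) (G := fun _ => (0 : ℂ))
    contDiffOn_const contDiffOn_const hz
  simpa using h

/-- The weighted poly-Bergman space: the elements of `L^{2,γ}` that are (represented by)
polyanalytic functions of order `n + 1` on the disc. -/
def polyBergman (γ : ℝ) (n : ℕ) : Submodule ℂ (L2 γ) where
  carrier := {f | ∃ F : ℂ → ℂ, IsPolyanalytic (n + 1) F ∧ f =ᵐ[weight γ] F}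
  zero_mem' := ⟨fun _ => 0, isPolyanalytic_zero _, Lp.coeFn_zero _ _ _⟩
  add_mem' := by
    rintro f g ⟨F, hF, hf⟩ ⟨G, hG, hg⟩
    refine ⟨_, hF.lin 1 hG, ?_⟩
    filter_upwards [Lp.coeFn_add f g, hf, hg] with z h1 h2 h3
    rw [h1, Pi.add_apply, h2, h3, one_mul]
  smul_mem' := by
    rintro a f ⟨F, hF, hf⟩
    refine ⟨_, hF.lin a (isPolyanalytic_zero _), ?_⟩
    filter_upwards [Lp.coeFn_smul a f, hf] with z h1 h2
    rw [h1, Pi.smul_apply, h2, smul_eq_mul, add_zero]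

/-- The `n`-th true weighted poly-Bergman space: the weighted Bergman space for `n = 0`, and the
orthogonal complement of the `(n-1)`-st poly-Bergman space in the `n`-th one for `n ≥ 1`. -/
def truePolyBergman (γ : ℝ) : ℕ → Submodule ℂ (L2 γ)
  | 0 => polyBergman γ 0
  | n + 1 => polyBergman γ (n + 1) ⊓ (polyBergman γ n)ᗮ

/-- The classical Jacobi polynomial `P_k^{(α,β)}`, in the form
`∑_s C(k+α, k-s) C(k+β, s) ((x-1)/2)^s ((x+1)/2)^(k-s)` with generalized binomial coefficients. -/
def jacobi (k : ℕ) (α β x : ℝ) : ℝ :=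
  ∑ s ∈ Finset.range (k + 1), Ring.choose (k + α) (k - s) * Ring.choose (k + β) s *
    ((x - 1) / 2) ^ s * ((x + 1) / 2) ^ (k - s)

/-- The Jacobi polynomial normalized to take the value `1` at `x = 1`. -/
def jacobiNormalized (k : ℕ) (α β x : ℝ) : ℝ :=
  jacobi k α β x / jacobi k α β 1

/-- The disc polynomial `R^γ_{m,n}`. The factor `z^m z̄^n / |z|^(2 min(m,n))` is written in its
reduced form `z^(m - min(m,n)) z̄^(n - min(m,n))`, which is also meaningful at `z = 0`. -/
def discPoly (γ : ℝ) (m n : ℕ) (z : ℂ) : ℂ :=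
  z ^ (m - min m n) * conj z ^ (n - min m n) *
    (jacobiNormalized (min m n) γ |(m : ℝ) - n| (2 * ‖z‖ ^ 2 - 1) : ℝ)

/-- A realization of a subspace `H` of `L^{2,γ}` as a reproducing kernel Hilbert space of functions
on the disc is by polyanalytic functions of order `k` if the function attached to each `f ∈ H` is
the polyanalytic representative of the class `f` (this representative is unique on the disc). -/
def IsPolyanalyticRealization (γ : ℝ) (k : ℕ) (H : Submodule ℂ (L2 γ))
    (R : RKHS ℂ H disc ℂ) : Prop :=
  ∀ f : H, ∃ F : ℂ → ℂ, IsPolyanalytic k F ∧ (f : L2 γ) =ᵐ[weight γ] F ∧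
    ∀ z : disc, R.coeCLM f z = F z

/-- The closed form of the reproducing kernel of the `n`-th true weighted poly-Bergman space. -/
def kernelFormula (γ : ℝ) (n : ℕ) (z w : ℂ) : ℂ :=
  (((γ + n + 1) / (Real.pi * n.factorial * (ascPochhammer ℝ n).eval (γ + 1)) *
      (1 - ‖z‖ ^ 2) ^ (-γ) * (1 - ‖w‖ ^ 2) ^ (-γ) : ℝ) : ℂ) *
    (dz^[n] fun ζ => (dzbar^[n] fun ω =>
      (((1 - ‖ζ‖ ^ 2) ^ (γ + n) * (1 - ‖ω‖ ^ 2) ^ (γ + n) : ℝ) : ℂ) *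
        ordinaryHypergeometric ((γ : ℂ) + n + 2) ((γ : ℂ) + 1) ((γ : ℂ) + n + 1) (ζ * conj ω)) w) z

end PolyBergman

end

open MeasureTheory
open scoped ComplexConjugate

noncomputable section

namespace PolyBergman

/-! Everything rests on one formula (`discPoly_eq`): `R_{m,n}` is the sum over `k ≤ n` of `(-1)^k
C(n,k)/(γ+1)_k · z̄^(n-k) (1-|z|²)^k` times the `k`-th derivative of `z^m`. Thus, for fixed `n`, one
differential operator of order `n` sends `z^m` to `R_{m,n}` for all `m`, and it sends power series
on the disc to polyanalytic functions of order `n + 1`. By the Leibniz rule the same operator is, up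
to a constant, `(1-|z|²)^(-γ) ∂_z^n (1-|z|²)^(γ+n)`: the Rodrigues formula.

Orthogonality: rotation invariance and Beta integrals turn the pairing of `z^a z̄^b` (`b ≤ n`) with
`R_{m,n}` into an `n`-th finite difference of `x ↦ C(x,b)`, which vanishes for `b < n` and is `1`
for `b = n`. As `R_{m,n}` is a multiple of `z^m z̄^n` plus terms of lower degree in `z̄`,
orthogonality and norms follow, and Stone–Weierstrass gives completeness in `L^{2,γ}`.

Identification of the spaces: a polyanalytic function is `∑_{j<n} z̄^j f_j` with holomorphic `f_j`.
On a smaller concentric ball rotation leaves at most one Taylor coefficient of each `f_j` in the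
pairing with `R_{m,k}`; letting the radius tend to `1` shows orthogonality to every `R_{m,k}` with
`k ≥ n`. Conversely, an `L²` series in the `R_{m,n}` with `n` fixed converges pointwise to a
polyanalytic function. So the `n`-th true space consists of the elements orthogonal to all `R_{m,k}`
with `k ≠ n` (`truePolyBergman_eq_discSpace`), and (i) and (ii) become statements about a Hilbert
basis.

Kernel: it is the sum over `m` of `R_{m,n}(z)` times the conjugate of `R_{m,n}(w)`, divided by
`‖R_{m,n}‖²`. The numbers `‖R_{m,n}‖⁻²` are, up to a constant, the Taylor coefficients of the
hypergeometric function, so the Rodrigues formula applied once in `w` and once in `z` gives the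
closed form. -/

/-! ### Rising factorials and the explicit form of the disc polynomials. -/

/-- The rising factorial `(γ + 1)_k`. -/
def poch (γ : ℝ) (k : ℕ) : ℝ := (ascPochhammer ℝ k).eval (γ + 1)

theorem poch_zero (γ : ℝ) : poch γ 0 = 1 := by simp [poch]

theorem poch_succ (γ : ℝ) (k : ℕ) : poch γ (k + 1) = poch γ k * (γ + 1 + k) :=
  ascPochhammer_succ_eval k _

theorem poch_pos {γ : ℝ} (hγ : -1 < γ) (k : ℕ) : 0 < poch γ k :=
  ascPochhammer_pos k _ (by linarith)

theorem poch_add (γ : ℝ) (j k : ℕ) : poch γ (j + k) = poch γ j * poch (γ + j) k := by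
  induction k with
  | zero => simp [poch_zero]
  | succ k ih =>
    rw [← add_assoc, poch_succ, ih, poch_succ]
    push_cast
    ring

theorem factorial_mul_choose_add (x : ℝ) (d : ℕ) :
    (d.factorial : ℝ) * Ring.choose (x + d) d = poch x d := by
  have h := Ring.descPochhammer_eq_factorial_smul_choose (x + d) d
  rw [Polynomial.descPochhammer_smeval_eq_ascPochhammer, Polynomial.ascPochhammer_smeval_eq_eval,
    nsmul_eq_mul] at h
  rw [← h, poch, add_sub_cancel_right]

/-- Splitting the product `(γ+1)_k` after `s` factors leaves `(γ+s+1)_{k-s}`, which is a factorial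
times a generalized binomial coefficient. This converts the coefficients of `jacobi` into rising
factorials. -/
theorem poch_mul_choose (γ : ℝ) {s k : ℕ} (h : s ≤ k) :
    poch γ s * (((k - s).factorial : ℝ) * Ring.choose (k + γ) (k - s)) = poch γ k := by
  obtain ⟨d, rfl⟩ := Nat.exists_eq_add_of_le h
  have : ((s + d : ℕ) : ℝ) + γ = (γ + s) + d := by push_cast; ring
  rw [Nat.add_sub_cancel_left, this, factorial_mul_choose_add, poch_add]

/-- The coefficients of the expansion of the disc polynomials in powers of `1 - |z|²`. -/
def discCoeff (γ : ℝ) (n k : ℕ) : ℝ := (-1) ^ k * n.choose k / poch γ k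

/-- At `x = 1` only the term `s = 0` survives, which gives the normalizing constant. With `β = q -
p` the coefficient `C(p+β, k)` is the ordinary `C(q,k)`, so the coefficients become symmetric in `p`
and `q`. In the application `t = |z|²`, `p = min m n` and `q = max m n`. -/
theorem jacobiNormalized_eq {γ : ℝ} (hγ : -1 < γ) (p q : ℕ) (t : ℝ) :
    jacobiNormalized p γ ((q : ℝ) - p) (2 * t - 1) =
      ∑ k ∈ Finset.range (p + 1), (-1) ^ k * k.factorial * p.choose k * q.choose k / poch γ k *
        (1 - t) ^ k * t ^ (p - k) := by
  have h1 : jacobi p γ ((q : ℝ) - p) 1 = poch γ p / p.factorial := by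
    rw [jacobi, Finset.sum_eq_single 0]
    · have := poch_mul_choose γ (Nat.zero_le p)
      rw [poch_zero, one_mul, Nat.sub_zero] at this
      rw [eq_div_iff (by positivity), ← this]
      simp [mul_comm]
    · intro s _ hs
      simp [hs]
    · simp
  rw [jacobiNormalized, h1, jacobi, Finset.sum_div]
  refine Finset.sum_congr rfl fun k hk => ?_
  have hk : k ≤ p := Nat.lt_succ_iff.mp (Finset.mem_range.mp hk)
  have e1 := poch_mul_choose γ hk
  have e2 : Ring.choose ((p : ℝ) + ((q : ℝ) - p)) k = q.choose k := by
    rw [add_sub_cancel, Ring.choose_natCast]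
  have e3 : (p.choose k : ℝ) * k.factorial * (p - k).factorial = p.factorial := by
    exact_mod_cast Nat.choose_mul_factorial_mul_factorial hk
  have e4 : ((2 * t - 1 - 1) / 2) ^ k = (-1) ^ k * (1 - t) ^ k := by
    rw [← mul_pow]; congr 1; ring
  have e5 : (2 * t - 1 + 1) / 2 = t := by ring
  have h0 := (poch_pos hγ k).ne'
  have h2 : Ring.choose ((p : ℝ) + γ) (p - k) ≠ 0 := by
    intro h
    rw [h, mul_zero, mul_zero] at e1
    exact (poch_pos hγ p).ne e1
  rw [e2, e4, e5, ← e1, ← e3]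
  field_simp

/-- The symmetry of `C(p,k) C(q,k)` removes the distinction between `m ≤ n` and `n ≤ m`, and `k!
C(m,k) z^(m-k)` is the `k`-th derivative of `z^m`. The range can be extended from `min m n` to `n`
because the falling factorial vanishes for `k > m`; the operator acting on `z^m` then no longer
depends on `m`. -/
theorem discPoly_eq {γ : ℝ} (hγ : -1 < γ) (m n : ℕ) (z : ℂ) :
    discPoly γ m n z = ∑ k ∈ Finset.range (n + 1), (discCoeff γ n k : ℂ) *
      (conj z ^ (n - k) * (1 - z * conj z) ^ k * (m.descFactorial k * z ^ (m - k))) := by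
  have hz : ((‖z‖ ^ 2 : ℝ) : ℂ) = z * conj z := by
    rw [Complex.mul_conj, Complex.normSq_eq_norm_sq]
  have key : discPoly γ m n z = ∑ k ∈ Finset.range (min m n + 1), (discCoeff γ n k : ℂ) *
      (conj z ^ (n - k) * (1 - z * conj z) ^ k * (m.descFactorial k * z ^ (m - k))) := by
    have hmn : |(m : ℝ) - n| = ((max m n : ℕ) : ℝ) - (min m n : ℕ) := by
      rcases le_total m n with h | h
      · have : (m : ℝ) ≤ n := by exact_mod_cast h
        rw [max_eq_right h, min_eq_left h, abs_of_nonpos (by linarith)]; ring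
      · have : (n : ℝ) ≤ m := by exact_mod_cast h
        rw [max_eq_left h, min_eq_right h, abs_of_nonneg (by linarith)]
    rw [discPoly, hmn, jacobiNormalized_eq hγ, Complex.ofReal_sum, Finset.mul_sum]
    refine Finset.sum_congr rfl fun k hk => ?_
    have hk : k ≤ min m n := Nat.lt_succ_iff.mp (Finset.mem_range.mp hk)
    have hkm : k ≤ m := hk.trans (min_le_left _ _)
    have hkn : k ≤ n := hk.trans (min_le_right _ _)
    have e1 : m - k = m - min m n + (min m n - k) := by omega
    have e2 : n - k = n - min m n + (min m n - k) := by omega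
    have e3 : (m.descFactorial k : ℂ) = k.factorial * m.choose k := by
      exact_mod_cast Nat.descFactorial_eq_factorial_mul_choose m k
    have e4 : (((min m n).choose k : ℝ) * ((max m n).choose k : ℝ)) = m.choose k * n.choose k := by
      rcases le_total m n with h | h <;> simp [h, mul_comm]
    rw [e1, e2, e3, discCoeff, pow_add, pow_add, mul_assoc _ ((min m n).choose k : ℝ), e4]
    push_cast at hz ⊢
    rw [hz, mul_pow]
    ring
  rw [key]
  refine Finset.sum_subset (by simp [Finset.range_subset_range]) fun k _ hk => ?_
  simp only [Finset.mem_range, not_lt] at hk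
  rcases lt_or_ge m k with h | h
  · simp [Nat.descFactorial_of_lt h]
  · have : n < k := by omega
    simp [discCoeff, Nat.choose_eq_zero_of_lt this]

/-! ### Two finite summations. -/

/-- The sum is the `n`-th forward difference at `A` of `x ↦ C(x,b)`. Each difference lowers `b` by
one, so `b = n` leaves the constant `1` and `b < n` leaves `0`. -/
theorem alternating_sum_choose_mul_choose (A : ℕ) {n b : ℕ} (hb : b ≤ n) :
    ∑ k ∈ Finset.range (n + 1), (-1 : ℝ) ^ k * n.choose k * (A + n - k).choose b =
      if b = n then 1 else 0 := by
  have h1 : (fwdDiff 1)^[n] (fun x : ℕ => (x.choose b : ℤ)) A = if b = n then 1 else 0 := by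
    split_ifs with h
    · subst h
      have := congrFun (fwdDiff_iter_choose 0 b) A
      simpa using this
    · obtain ⟨d, rfl⟩ := Nat.exists_eq_add_of_lt (lt_of_le_of_ne hb h)
      have := fwdDiff_iter_choose 0 b
      rw [show b + d + 1 = d + 1 + b by ring, Function.iterate_add_apply]
      rw [add_zero] at this
      rw [this, Function.iterate_succ_apply]
      simp only [Nat.choose_zero_right, Nat.cast_one, fwdDiff_const]
      simp [fwdDiff_iter_eq_sum_shift]
  rw [fwdDiff_iter_eq_sum_shift, ← Finset.sum_range_reflect] at h1
  have h2 := congrArg (Int.cast : ℤ → ℝ) h1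
  rw [Int.cast_sum] at h2
  have h3 : (((if b = n then 1 else 0 : ℤ)) : ℝ) = if b = n then 1 else 0 := by
    split_ifs <;> simp
  rw [← h3, ← h2]
  refine Finset.sum_congr rfl fun k hk => ?_
  have hk : k ≤ n := Nat.lt_succ_iff.mp (Finset.mem_range.mp hk)
  have e2 : n - (n - k) = k := by omega
  have e3 : A + (n - k) = A + n - k := by omega
  simp [e2, e3, Nat.choose_symm hk]

/-- This is Vandermonde's identity for `C(m + (n + γ), n)`. The left side is the coefficient of `z^m
z̄^n` in `R_{m,n}`, since `(1-|z|²)^k` contributes `(-1)^k |z|^(2k)` to it. -/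
theorem sum_discCoeff_leading {γ : ℝ} (hγ : -1 < γ) (m n : ℕ) :
    ∑ k ∈ Finset.range (n + 1), (-1) ^ k * (discCoeff γ n k * m.descFactorial k) =
      poch γ (m + n) / (poch γ m * poch γ n) := by
  have h1 := factorial_mul_choose_add (γ + m) n
  have h2 := poch_add γ m n
  have e : γ + m + n = (m : ℝ) + (n + γ) := by ring
  rw [e, Ring.add_choose_eq _ (Commute.all _ _), Finset.Nat.sum_antidiagonal_eq_sum_range_succ_mk,
    Finset.mul_sum] at h1
  rw [h2, mul_div_mul_left _ _ (poch_pos hγ m).ne', ← h1, Finset.sum_div]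
  refine Finset.sum_congr rfl fun k hk => ?_
  have hk : k ≤ n := Nat.lt_succ_iff.mp (Finset.mem_range.mp hk)
  have e1 := poch_mul_choose γ hk
  have e3 : (n.choose k : ℝ) * k.factorial * (n - k).factorial = n.factorial := by
    exact_mod_cast Nat.choose_mul_factorial_mul_factorial hk
  have e4 : (m.descFactorial k : ℝ) = k.factorial * m.choose k := by
    exact_mod_cast Nat.descFactorial_eq_factorial_mul_choose m k
  have h0 := (poch_pos hγ k).ne'
  have h3 : Ring.choose ((n : ℝ) + γ) (n - k) ≠ 0 := by
    intro h
    rw [h, mul_zero, mul_zero] at e1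
    exact (poch_pos hγ n).ne e1
  have e5 : ((-1 : ℝ) ^ k * (-1) ^ k) = 1 := by rw [← mul_pow]; norm_num
  rw [← e1, ← e3, e4, Ring.choose_natCast, discCoeff]
  field_simp
  rw [show ((-1 : ℝ) ^ k) ^ 2 = 1 by rw [sq, e5], one_mul]

/-! ### The weighted measure: Beta integrals and rotation invariance. -/

theorem one_sub_norm_sq_pos {z : ℂ} (hz : z ∈ disc) : 0 < 1 - ‖z‖ ^ 2 := by
  rw [mem_ball_zero_iff] at hz
  nlinarith [norm_nonneg z]

theorem measurable_weight_density (γ : ℝ) :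
    Measurable fun z : ℂ => ENNReal.ofReal ((1 - ‖z‖ ^ 2) ^ γ) := by
  fun_prop

theorem integral_weight {E : Type*} [NormedAddCommGroup E] [NormedSpace ℝ E] (γ : ℝ) (f : ℂ → E) :
    ∫ z, f z ∂weight γ = ∫ z in disc, ((1 - ‖z‖ ^ 2) ^ γ) • f z := by
  rw [weight, integral_withDensity_eq_integral_toReal_smul (measurable_weight_density γ)
    (Filter.Eventually.of_forall fun _ => ENNReal.ofReal_lt_top)]
  refine setIntegral_congr_fun measurableSet_ball fun z hz => ?_
  rw [ENNReal.toReal_ofReal (Real.rpow_nonneg (one_sub_norm_sq_pos hz).le _)]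

theorem ae_mem_disc (γ : ℝ) : ∀ᵐ z ∂weight γ, z ∈ disc :=
  (withDensity_absolutelyContinuous _ _).ae_le (ae_restrict_mem measurableSet_ball)

theorem integrableOn_weight {γ : ℝ} (hγ : -1 < γ) :
    IntegrableOn (fun z : ℂ => (1 - ‖z‖ ^ 2) ^ γ) disc := by
  rw [integrableOn_fun_norm_addHaar volume (f := fun y => (1 - y ^ 2) ^ γ)]
  have h1 : IntervalIntegrable (fun y : ℝ => (1 - y) ^ γ) volume 0 1 := by
    have := ((intervalIntegral.intervalIntegrable_rpow' hγ (a := 0) (b := 1)).comp_sub_left 1).symm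
    simpa using this
  have h2 : IntervalIntegrable (fun y : ℝ => (1 - y) ^ γ * (y * (1 + y) ^ γ)) volume 0 1 := by
    refine h1.mul_continuousOn (ContinuousOn.mul continuousOn_id ?_)
    refine ContinuousOn.rpow_const (by fun_prop) fun x hx => Or.inl ?_
    rw [Set.uIcc_of_le zero_le_one] at hx
    linarith [hx.1]
  rw [intervalIntegrable_iff_integrableOn_Ioo_of_le zero_le_one] at h2
  refine h2.congr_fun (fun y hy => ?_) measurableSet_Ioo
  simp only [Complex.finrank_real_complex, smul_eq_mul]
  -- Only the factor `(1-y)^γ` is singular on `[0,1]`; it is integrable because `γ > -1`.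
  rw [show 1 - y ^ 2 = (1 - y) * (1 + y) by ring,
    Real.mul_rpow (by linarith [hy.2]) (by linarith [hy.1])]
  ring

theorem isFiniteMeasure_weight {γ : ℝ} (hγ : -1 < γ) : IsFiniteMeasure (weight γ) := by
  refine isFiniteMeasure_withDensity ?_
  have h := (integrableOn_weight hγ).hasFiniteIntegral
  rw [hasFiniteIntegral_iff_ofReal] at h
  · exact h.ne
  · exact (ae_restrict_iff' measurableSet_ball).mpr
      (Filter.Eventually.of_forall fun z hz => Real.rpow_nonneg (one_sub_norm_sq_pos hz).le _)

theorem integral_pow_mul_one_sub_rpow {s : ℝ} (hs : -1 < s) (N : ℕ) :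
    ∫ x in (0 : ℝ)..1, x ^ N * (1 - x) ^ s = N.factorial / poch s (N + 1) := by
  have h := Complex.betaIntegral_eval_nat_add_one_right (u := (s + 1 : ℂ)) (by simp; linarith) N
  rw [Complex.betaIntegral_symm, Complex.betaIntegral] at h
  have h1 : ∀ k : ℕ, ∏ j ∈ Finset.range k, ((s : ℂ) + 1 + j) = (poch s k : ℂ) := by
    intro k
    induction k with
    | zero => simp [poch_zero]
    | succ k ih => rw [Finset.prod_range_succ, ih, poch_succ]; push_cast; ring
  rw [h1] at h
  have h2 : ∫ x in (0 : ℝ)..1, ((x : ℂ) ^ ((N : ℂ) + 1 - 1) * (1 - (x : ℂ)) ^ ((s : ℂ) + 1 - 1)) =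
      ∫ x in (0 : ℝ)..1, ((x ^ N * (1 - x) ^ s : ℝ) : ℂ) := by
    refine intervalIntegral.integral_congr fun x hx => ?_
    rw [Set.uIcc_of_le zero_le_one] at hx
    simp only [add_sub_cancel_right, Complex.cpow_natCast]
    rw [Complex.ofReal_mul, Complex.ofReal_cpow (by linarith [hx.2])]
    push_cast
    rfl
  rw [h2, intervalIntegral.integral_ofReal] at h
  exact_mod_cast h

theorem integral_radial {γ : ℝ} (hγ : -1 < γ) (N k : ℕ) :
    ∫ z, (1 - ‖z‖ ^ 2) ^ k * ‖z‖ ^ (2 * N) ∂weight γ =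
      Real.pi * (N.factorial / poch (γ + k) (N + 1)) := by
  have hs : -1 < γ + k := by linarith [(Nat.cast_nonneg k : (0 : ℝ) ≤ k)]
  rw [integral_weight, ← integral_indicator measurableSet_ball]
  -- Polar coordinates integrate over the whole half-line, so the disc is encoded by the cutoff `t <
  -- 1`. The substitution `t = |z|²` then produces a Beta integral, the weight and `(1-|z|²)^k`
  -- merging into the exponent `γ + k`.
  let G : ℝ → ℝ := (Set.Iio 1).indicator fun t => t ^ N * (1 - t) ^ (γ + k)
  have h1 : (disc.indicator fun z : ℂ => ((1 - ‖z‖ ^ 2) ^ γ) • ((1 - ‖z‖ ^ 2) ^ k * ‖z‖ ^ (2 * N)))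
      = fun z => (fun y : ℝ => G (y ^ (2 : ℝ))) ‖z‖ := by
    ext z
    by_cases hz : z ∈ disc
    · have h0 := one_sub_norm_sq_pos hz
      have : ‖z‖ ^ 2 ∈ Set.Iio (1 : ℝ) := by simp only [Set.mem_Iio]; linarith
      simp only [G, Real.rpow_two]
      rw [Set.indicator_of_mem hz, Set.indicator_of_mem this, Real.rpow_add_natCast h0.ne',
        smul_eq_mul]
      ring
    · have : ‖z‖ ^ 2 ∉ Set.Iio (1 : ℝ) := by
        rw [mem_ball_zero_iff] at hz
        simp only [Set.mem_Iio]
        nlinarith [norm_nonneg z]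
      simp only [G, Real.rpow_two]
      rw [Set.indicator_of_notMem hz, Set.indicator_of_notMem this]
  rw [h1, integral_fun_norm_addHaar volume (fun y : ℝ => G (y ^ (2 : ℝ)))]
  have h2 := integral_comp_rpow_Ioi_of_pos (g := G) (p := 2) two_pos
  have h3 : ∫ x in Set.Ioi (0 : ℝ), (2 * x ^ ((2 : ℝ) - 1)) • G (x ^ (2 : ℝ)) =
      2 * ∫ x in Set.Ioi (0 : ℝ), x ^ (Module.finrank ℝ ℂ - 1) • G (x ^ (2 : ℝ)) := by
    rw [← integral_const_mul]
    refine integral_congr_ae (Filter.Eventually.of_forall fun x => ?_)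
    simp only [Complex.finrank_real_complex, smul_eq_mul]
    norm_num
    ring
  have h4 : ∫ t in Set.Ioi (0 : ℝ), G t = N.factorial / poch (γ + k) (N + 1) := by
    rw [← integral_pow_mul_one_sub_rpow hs, intervalIntegral.integral_of_le zero_le_one,
      setIntegral_indicator measurableSet_Iio, integral_Ioc_eq_integral_Ioo]
    rfl
  have h5 : (volume : Measure ℂ).real (Metric.ball 0 1) = Real.pi := by
    simp [Measure.real, Complex.volume_ball]
  rw [h3, h4] at h2
  rw [h5, Complex.finrank_real_complex, ← h2, Complex.finrank_real_complex, nsmul_eq_mul,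
    smul_eq_mul]
  push_cast
  ring

theorem integral_comp_rotation {γ : ℝ} (c : Circle) (h : ℂ → ℂ) :
    ∫ z, h (c * z) ∂weight γ = ∫ z, h z ∂weight γ := by
  have key := (rotation c).measurePreserving.integral_comp'
    (f := (rotation c).toHomeomorph.toMeasurableEquiv)
    (disc.indicator fun z => ((1 - ‖z‖ ^ 2) ^ γ) • h z)
  rw [integral_weight, integral_weight, ← integral_indicator measurableSet_ball,
    ← integral_indicator measurableSet_ball, ← key]
  refine integral_congr_ae (Filter.Eventually.of_forall fun z => ?_)
  change _ = disc.indicator (fun z => ((1 - ‖z‖ ^ 2) ^ γ) • h z) (rotation c z)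
  rw [rotation_apply]
  have hn : ‖(c : ℂ) * z‖ = ‖z‖ := by rw [norm_mul, Circle.norm_coe, one_mul]
  by_cases hz : z ∈ disc
  · have : (c : ℂ) * z ∈ disc := by rw [mem_ball_zero_iff, hn]; rwa [mem_ball_zero_iff] at hz
    rw [Set.indicator_of_mem hz, Set.indicator_of_mem this, hn]
  · have : (c : ℂ) * z ∉ disc := by rw [mem_ball_zero_iff, hn]; rwa [mem_ball_zero_iff] at hz
    rw [Set.indicator_of_notMem hz, Set.indicator_of_notMem this]

/-- A function of nonzero angular weight has vanishing integral. -/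
theorem integral_eq_zero_of_rotation {γ : ℝ} {p q : ℕ} (hpq : p ≠ q) {h : ℂ → ℂ}
    (hh : ∀ (c : Circle) (z : ℂ), h (c * z) = c ^ p * conj (c : ℂ) ^ q * h z) :
    ∫ z, h z ∂weight γ = 0 := by
  have hne : (p : ℝ) - q ≠ 0 := sub_ne_zero.mpr (by exact_mod_cast hpq)
  have hne' : (p : ℂ) - q ≠ 0 := sub_ne_zero.mpr (by exact_mod_cast hpq)
  -- The angle is chosen so that `c^(p-q) = e^(iπ) = -1`: the integral equals its own negative.
  let c : Circle := Circle.exp (Real.pi / (p - q))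
  have hc : (c : ℂ) ^ p * conj (c : ℂ) ^ q = -1 := by
    rw [← Circle.coe_inv_eq_conj, ← Circle.exp_neg, Circle.coe_exp, Circle.coe_exp,
      ← Complex.exp_nat_mul, ← Complex.exp_nat_mul, ← Complex.exp_add, ← Complex.exp_pi_mul_I]
    congr 1
    push_cast
    field_simp
    ring
  have h1 := integral_comp_rotation (γ := γ) c h
  simp_rw [hh, hc, neg_one_mul, integral_neg] at h1
  exact self_eq_neg.mp h1.symm

theorem memLp_of_continuous {γ : ℝ} (hγ : -1 < γ) {f : ℂ → ℂ} (hf : Continuous f)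
    (p : ENNReal) : MemLp f p (weight γ) := by
  have := isFiniteMeasure_weight hγ
  obtain ⟨C, hC⟩ := (isCompact_closedBall (0 : ℂ) 1).exists_bound_of_continuousOn hf.continuousOn
  refine MemLp.of_bound hf.aestronglyMeasurable C ?_
  filter_upwards [ae_mem_disc γ] with z hz
  exact hC z (Metric.ball_subset_closedBall hz)

theorem integrable_of_continuous {γ : ℝ} (hγ : -1 < γ) {f : ℂ → ℂ} (hf : Continuous f) :
    Integrable f (weight γ) :=
  memLp_one_iff_integrable.mp (memLp_of_continuous hγ hf 1)

theorem integral_monomial {γ : ℝ} (hγ : -1 < γ) (a b k : ℕ) :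
    ∫ z, (1 - z * conj z) ^ k * (z ^ a * conj z ^ b) ∂weight γ =
      if a = b then ((Real.pi * (a.factorial / poch (γ + k) (a + 1)) : ℝ) : ℂ) else 0 := by
  split_ifs with h
  · subst h
    rw [← integral_radial hγ, ← integral_complex_ofReal]
    refine integral_congr_ae (Filter.Eventually.of_forall fun z => ?_)
    simp only
    rw [← mul_pow, Complex.mul_conj, Complex.normSq_eq_norm_sq]
    push_cast
    ring
  · refine integral_eq_zero_of_rotation h fun c z => ?_
    have hc : (c : ℂ) * conj (c : ℂ) = 1 := by
      rw [Complex.mul_conj, Complex.normSq_eq_norm_sq, Circle.norm_coe]; simp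
    have : (c : ℂ) * z * conj ((c : ℂ) * z) = z * conj z := by
      rw [map_mul, mul_mul_mul_comm, hc, one_mul]
    rw [this, map_mul, mul_pow, mul_pow]
    ring

/-! ### Orthogonality relations of the disc polynomials. -/

theorem continuous_discPoly {γ : ℝ} (hγ : -1 < γ) (m n : ℕ) : Continuous (discPoly γ m n) := by
  have : discPoly γ m n = _ := funext (discPoly_eq hγ m n)
  rw [this]
  have := Complex.continuous_conj
  fun_prop

theorem conj_discPoly {γ : ℝ} (hγ : -1 < γ) (m n : ℕ) (z : ℂ) :
    conj (discPoly γ m n z) = ∑ k ∈ Finset.range (n + 1), (discCoeff γ n k : ℂ) *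
      (z ^ (n - k) * (1 - z * conj z) ^ k * (m.descFactorial k * conj z ^ (m - k))) := by
  rw [discPoly_eq hγ, map_sum]
  refine Finset.sum_congr rfl fun k _ => ?_
  simp only [map_mul, map_pow, map_sub, map_one, Complex.conj_conj, Complex.conj_ofReal,
    map_natCast]
  rw [mul_comm (conj z) z]

/-- Rotation invariance forces `a + n = b + m`. Then the `k`-th Beta integral combines with
`discCoeff` into a factor independent of `k` times `(-1)^k C(n,k) C(a+n-k, b)`, and the sum over `k`
is a finite difference. -/
theorem integral_monomial_mul_conj_discPoly {γ : ℝ} (hγ : -1 < γ) (a m : ℕ) {b n : ℕ}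
    (hb : b ≤ n) :
    ∫ z, z ^ a * conj z ^ b * conj (discPoly γ m n z) ∂weight γ =
      if a = m ∧ b = n then
        ((Real.pi * m.factorial * n.factorial / poch γ (m + n + 1) : ℝ) : ℂ) else 0 := by
  have hcc := Complex.continuous_conj
  have h1 : ∫ z, z ^ a * conj z ^ b * conj (discPoly γ m n z) ∂weight γ =
      ∑ k ∈ Finset.range (n + 1), (discCoeff γ n k : ℂ) * m.descFactorial k *
        ∫ z, (1 - z * conj z) ^ k * (z ^ (a + (n - k)) * conj z ^ (b + (m - k))) ∂weight γ := by
    simp_rw [← integral_const_mul]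
    rw [← integral_finsetSum _ fun k _ => integrable_of_continuous hγ (by fun_prop)]
    refine integral_congr_ae (Filter.Eventually.of_forall fun z => ?_)
    simp only
    rw [conj_discPoly hγ, Finset.mul_sum]
    refine Finset.sum_congr rfl fun k _ => ?_
    rw [pow_add, pow_add]
    ring
  rw [h1]
  simp_rw [integral_monomial hγ]
  by_cases hab : a + n = b + m
  · have h2 : ∀ k ∈ Finset.range (n + 1), (discCoeff γ n k : ℂ) * m.descFactorial k *
        (if a + (n - k) = b + (m - k) then
          ((Real.pi * ((a + (n - k)).factorial / poch (γ + k) (a + (n - k) + 1)) : ℝ) : ℂ) else 0)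
        = ((Real.pi * m.factorial * b.factorial / poch γ (a + n + 1) *
          ((-1 : ℝ) ^ k * n.choose k * (a + n - k).choose b) : ℝ) : ℂ) := by
      intro k hk
      have hk : k ≤ n := Nat.lt_succ_iff.mp (Finset.mem_range.mp hk)
      rcases lt_or_ge m k with hmk | hmk
      -- For `k > m` both sides vanish: the falling factorial on the left, and on the right
      -- `C(a+n-k, b)`, as `a+n-k < b`.
      · rw [Nat.descFactorial_of_lt hmk, Nat.choose_eq_zero_of_lt (by omega : a + n - k < b)]
        simp
      -- The factor `(γ+1)_k` from `discCoeff` and the denominator of the Beta integral multiply to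
      -- `(γ+1)_{a+n+1}`, which is free of `k`.
      · have e5 : poch γ (a + n + 1) = poch γ k * poch (γ + k) (a + (n - k) + 1) := by
          rw [← poch_add]
          congr 1
          omega
        rw [if_pos (by omega), e5, discCoeff]
        have e1 : a + n - k = b + (m - k) := by omega
        have e2 : a + (n - k) = b + (m - k) := by omega
        have e3 : (((b + (m - k)).choose b : ℝ) * b.factorial * (m - k).factorial) =
            (b + (m - k)).factorial := by
          rw [Nat.choose_symm_add]
          exact_mod_cast Nat.add_choose_mul_factorial_mul_factorial b (m - k)
        have e4 : (((m - k).factorial : ℝ) * m.descFactorial k) = m.factorial := by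
          exact_mod_cast Nat.factorial_mul_descFactorial hmk
        have h3 := (poch_pos hγ k).ne'
        have h4 := (poch_pos (γ := γ + k)
          (by linarith [(Nat.cast_nonneg k : (0 : ℝ) ≤ k)]) (b + (m - k) + 1)).ne'
        rw [e1, e2, ← e3, ← e4]
        norm_cast
        push_cast
        field_simp
    rw [Finset.sum_congr rfl h2, ← Complex.ofReal_sum, ← Finset.mul_sum,
      alternating_sum_choose_mul_choose a hb]
    by_cases hbn : b = n
    · have : a = m := by omega
      subst hbn this
      simp
    · simp [hbn]
  · rw [if_neg (by omega)]
    refine Finset.sum_eq_zero fun k hk => ?_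
    have hk : k ≤ n := Nat.lt_succ_iff.mp (Finset.mem_range.mp hk)
    rcases lt_or_ge m k with hmk | hmk
    · simp [Nat.descFactorial_of_lt hmk]
    · rw [if_neg (by omega), mul_zero]

/-- The span of the monomials `z^a z̄^b` with `b < N`. -/
def lowSpan (N : ℕ) : Submodule ℂ (ℂ → ℂ) :=
  Submodule.span ℂ {f | ∃ a b, b < N ∧ f = fun z => z ^ a * conj z ^ b}

theorem monomial_mem_lowSpan (a : ℕ) {b N : ℕ} (h : b < N) :
    (fun z : ℂ => z ^ a * conj z ^ b) ∈ lowSpan N :=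
  Submodule.subset_span ⟨a, b, h, rfl⟩

theorem lowSpan_mono {M N : ℕ} (h : M ≤ N) : lowSpan M ≤ lowSpan N :=
  Submodule.span_mono fun _ ⟨a, b, hb, e⟩ => ⟨a, b, hb.trans_le h, e⟩

theorem one_sub_mul_mem_lowSpan {N : ℕ} {f : ℂ → ℂ} (hf : f ∈ lowSpan N) :
    (fun z => (1 - z * conj z) * f z) ∈ lowSpan (N + 1) := by
  induction hf using Submodule.span_induction with
  | mem f hf =>
    obtain ⟨a, b, hb, rfl⟩ := hf
    have : (fun z : ℂ => (1 - z * conj z) * (z ^ a * conj z ^ b)) =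
        (fun z => z ^ a * conj z ^ b) - fun z => z ^ (a + 1) * conj z ^ (b + 1) := by
      ext z; simp only [Pi.sub_apply]; ring
    rw [this]
    exact sub_mem (monomial_mem_lowSpan _ (by omega)) (monomial_mem_lowSpan _ (by omega))
  | zero => simpa using! zero_mem _
  | add f g _ _ hf hg =>
    convert! add_mem hf hg using 1
    ext z; simp only [Pi.add_apply]; ring
  | smul c f _ hf =>
    convert! Submodule.smul_mem _ c hf using 1
    ext z; simp only [Pi.smul_apply, smul_eq_mul]; ring

/-- Modulo lower powers of `z̄`, multiplication by `1 - z z̄` is multiplication by `-z z̄`. -/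
theorem one_sub_pow_mul_monomial_sub_mem (p q k : ℕ) :
    (fun z : ℂ => (1 - z * conj z) ^ k * (z ^ p * conj z ^ q) -
      (-1) ^ k * (z ^ (p + k) * conj z ^ (q + k))) ∈ lowSpan (q + k) := by
  induction k with
  | zero => simpa using! zero_mem _
  | succ k ih =>
    convert! add_mem (one_sub_mul_mem_lowSpan ih) (Submodule.smul_mem _ ((-1 : ℂ) ^ k)
      (monomial_mem_lowSpan (p + k) (by omega : q + k < q + k + 1))) using 1
    ext z
    simp only [Pi.add_apply, Pi.smul_apply, smul_eq_mul]
    ring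

/-- The coefficient of `z^m z̄^n` in the disc polynomial `R_{m,n}`. -/
def leadCoeff (γ : ℝ) (m n : ℕ) : ℝ := poch γ (m + n) / (poch γ m * poch γ n)

theorem leadCoeff_pos {γ : ℝ} (hγ : -1 < γ) (m n : ℕ) : 0 < leadCoeff γ m n :=
  div_pos (poch_pos hγ _) (mul_pos (poch_pos hγ _) (poch_pos hγ _))

theorem discPoly_sub_leading_mem {γ : ℝ} (hγ : -1 < γ) (m n : ℕ) :
    (discPoly γ m n - (leadCoeff γ m n : ℂ) • fun z => z ^ m * conj z ^ n) ∈ lowSpan n := by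
  have : (discPoly γ m n - (leadCoeff γ m n : ℂ) • fun z => z ^ m * conj z ^ n) =
      ∑ k ∈ Finset.range (n + 1), ((discCoeff γ n k : ℂ) * m.descFactorial k) •
        fun z : ℂ => (1 - z * conj z) ^ k * (z ^ (m - k) * conj z ^ (n - k)) -
          (-1) ^ k * (z ^ m * conj z ^ n) := by
    ext z
    rw [leadCoeff, ← sum_discCoeff_leading hγ]
    simp only [Pi.sub_apply, Pi.smul_apply, Finset.sum_apply, smul_eq_mul, discPoly_eq hγ]
    rw [Complex.ofReal_sum, Finset.sum_mul, ← Finset.sum_sub_distrib]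
    refine Finset.sum_congr rfl fun k _ => ?_
    push_cast
    ring
  rw [this]
  refine sum_mem fun k hk => ?_
  have hk : k ≤ n := Nat.lt_succ_iff.mp (Finset.mem_range.mp hk)
  rcases lt_or_ge m k with hmk | hmk
  · simp [Nat.descFactorial_of_lt hmk]
  · have := one_sub_pow_mul_monomial_sub_mem (m - k) (n - k) k
    rw [Nat.sub_add_cancel hmk, Nat.sub_add_cancel hk] at this
    exact Submodule.smul_mem _ _ this

theorem continuous_of_mem_lowSpan {N : ℕ} {f : ℂ → ℂ} (hf : f ∈ lowSpan N) : Continuous f := by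
  have hcc := Complex.continuous_conj
  induction hf using Submodule.span_induction with
  | mem f hf =>
    obtain ⟨a, b, hb, rfl⟩ := hf
    fun_prop
  | zero => exact continuous_zero
  | add f g _ _ hf hg => exact hf.add hg
  | smul c f _ hf => exact hf.const_smul c

theorem integral_lowSpan_mul_conj_discPoly {γ : ℝ} (hγ : -1 < γ) (m : ℕ) {n : ℕ} {f : ℂ → ℂ}
    (hf : f ∈ lowSpan n) : ∫ z, f z * conj (discPoly γ m n z) ∂weight γ = 0 := by
  have hcc := Complex.continuous_conj
  have hR := continuous_discPoly hγ m n
  induction hf using Submodule.span_induction with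
  | mem f hf =>
    obtain ⟨a, b, hb, rfl⟩ := hf
    rw [integral_monomial_mul_conj_discPoly hγ a m hb.le, if_neg (by omega)]
  | zero => simp
  | add f g hf' hg' hf hg =>
    have := continuous_of_mem_lowSpan hf'
    have := continuous_of_mem_lowSpan hg'
    simp_rw [Pi.add_apply, add_mul]
    rw [integral_add (integrable_of_continuous hγ (by fun_prop))
      (integrable_of_continuous hγ (by fun_prop)), hf, hg, add_zero]
  | smul c f hf' hf =>
    simp_rw [Pi.smul_apply, smul_eq_mul, mul_assoc]
    rw [integral_const_mul, hf, mul_zero]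

/-- The squared norm of the disc polynomial `R_{m,n}`. -/
def normSqDisc (γ : ℝ) (m n : ℕ) : ℝ :=
  Real.pi * m.factorial * n.factorial / ((γ + 1 + m + n) * poch γ m * poch γ n)

theorem normSqDisc_pos {γ : ℝ} (hγ : -1 < γ) (m n : ℕ) : 0 < normSqDisc γ m n := by
  have h1 := poch_pos hγ m
  have h2 := poch_pos hγ n
  have h3 : 0 < γ + 1 + m + n := by
    linarith [(Nat.cast_nonneg m : (0 : ℝ) ≤ m), (Nat.cast_nonneg n : (0 : ℝ) ≤ n)]
  unfold normSqDisc
  positivity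

/-- Only the polynomial with the smaller second index is expanded: its terms of degree below `n` in
`z̄` are orthogonal to `R_{m',n'}`, so the integral is `leadCoeff` times a single monomial pairing.
-/
theorem integral_discPoly_mul_conj_of_le {γ : ℝ} (hγ : -1 < γ) (m m' : ℕ) {n n' : ℕ}
    (h : n ≤ n') : ∫ z, discPoly γ m n z * conj (discPoly γ m' n' z) ∂weight γ =
      if m = m' ∧ n = n' then (normSqDisc γ m n : ℂ) else 0 := by
  have hcc := Complex.continuous_conj
  have hR := continuous_discPoly hγ m' n'
  have hlow := discPoly_sub_leading_mem hγ m n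
  have hlow' := continuous_of_mem_lowSpan hlow
  have h1 : ∀ z, discPoly γ m n z * conj (discPoly γ m' n' z) =
      (discPoly γ m n - (leadCoeff γ m n : ℂ) • fun z : ℂ => z ^ m * conj z ^ n) z *
        conj (discPoly γ m' n' z) +
      leadCoeff γ m n * (z ^ m * conj z ^ n * conj (discPoly γ m' n' z)) := by
    intro z
    simp only [Pi.sub_apply, Pi.smul_apply, smul_eq_mul]
    ring
  simp_rw [h1]
  rw [integral_add (integrable_of_continuous hγ (by fun_prop))
    (integrable_of_continuous hγ (by fun_prop)),
    integral_lowSpan_mul_conj_discPoly hγ m' (lowSpan_mono h hlow), zero_add, integral_const_mul,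
    integral_monomial_mul_conj_discPoly hγ m m' h]
  split_ifs with hh
  · obtain ⟨rfl, rfl⟩ := hh
    have h1 := (poch_pos hγ m).ne'
    have h2 := (poch_pos hγ n).ne'
    have h3 := (poch_pos hγ (m + n)).ne'
    rw [← Complex.ofReal_mul, leadCoeff, normSqDisc, poch_succ]
    congr 1
    push_cast
    field_simp
    ring
  · simp

theorem integral_discPoly_mul_conj {γ : ℝ} (hγ : -1 < γ) (m n m' n' : ℕ) :
    ∫ z, discPoly γ m n z * conj (discPoly γ m' n' z) ∂weight γ =
      if m = m' ∧ n = n' then (normSqDisc γ m n : ℂ) else 0 := by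
  rcases le_total n n' with h | h
  · exact integral_discPoly_mul_conj_of_le hγ m m' h
  · have h1 := congrArg conj (integral_discPoly_mul_conj_of_le hγ m' m h)
    rw [← integral_conj] at h1
    simp only [map_mul, Complex.conj_conj] at h1
    simp_rw [mul_comm (discPoly γ m n _)]
    rw [h1]
    by_cases hh : m' = m ∧ n' = n
    · obtain ⟨rfl, rfl⟩ := hh
      simp
    · rw [if_neg hh, if_neg (fun h => hh ⟨h.1.symm, h.2.symm⟩), map_zero]

/-! ### Completeness of the disc polynomials. -/

/-- The class in `L^{2,γ}` of a continuous function. -/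
def ofContinuous {γ : ℝ} (hγ : -1 < γ) {f : ℂ → ℂ} (hf : Continuous f) : L2 γ :=
  (memLp_of_continuous hγ hf 2).toLp f

theorem coeFn_ofContinuous {γ : ℝ} (hγ : -1 < γ) {f : ℂ → ℂ} (hf : Continuous f) :
    ofContinuous hγ hf =ᵐ[weight γ] f :=
  MemLp.coeFn_toLp _

theorem inner_ofContinuous {γ : ℝ} (hγ : -1 < γ) {f : ℂ → ℂ} (hf : Continuous f) (g : L2 γ) :
    inner ℂ (ofContinuous hγ hf) g = ∫ z, g z * conj (f z) ∂weight γ := by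
  rw [L2.inner_def]
  refine integral_congr_ae ?_
  filter_upwards [coeFn_ofContinuous hγ hf] with z hz
  rw [hz, RCLike.inner_apply]

/-- The disc polynomial `R_{m,n}` as an element of `L^{2,γ}`. -/
def discL2 {γ : ℝ} (hγ : -1 < γ) (m n : ℕ) : L2 γ :=
  ofContinuous hγ (continuous_discPoly hγ m n)

theorem coeFn_discL2 {γ : ℝ} (hγ : -1 < γ) (m n : ℕ) :
    discL2 hγ m n =ᵐ[weight γ] discPoly γ m n :=
  coeFn_ofContinuous _ _

theorem inner_discL2 {γ : ℝ} (hγ : -1 < γ) (m n m' n' : ℕ) :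
    inner ℂ (discL2 hγ m n) (discL2 hγ m' n') =
      if m = m' ∧ n = n' then (normSqDisc γ m n : ℂ) else 0 := by
  rw [discL2, inner_ofContinuous]
  have h : ∫ z, discL2 hγ m' n' z * conj (discPoly γ m n z) ∂weight γ =
      ∫ z, discPoly γ m' n' z * conj (discPoly γ m n z) ∂weight γ := by
    refine integral_congr_ae ?_
    filter_upwards [coeFn_discL2 hγ m' n'] with z hz
    rw [hz]
  rw [h, integral_discPoly_mul_conj hγ]
  by_cases hh : m' = m ∧ n' = n
  · obtain ⟨rfl, rfl⟩ := hh
    simp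
  · rw [if_neg hh, if_neg (fun h => hh ⟨h.1.symm, h.2.symm⟩)]

/-- The span of all monomials `z^a z̄^b`. -/
def monomialSpan : Submodule ℂ (ℂ → ℂ) :=
  Submodule.span ℂ {f | ∃ a b : ℕ, f = fun z => z ^ a * conj z ^ b}

theorem monomial_mem (a b : ℕ) : (fun z : ℂ => z ^ a * conj z ^ b) ∈ monomialSpan :=
  Submodule.subset_span ⟨a, b, rfl⟩

theorem continuous_of_mem_monomialSpan {f : ℂ → ℂ} (hf : f ∈ monomialSpan) : Continuous f := by
  have hcc := Complex.continuous_conj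
  induction hf using Submodule.span_induction with
  | mem f hf =>
    obtain ⟨a, b, rfl⟩ := hf
    fun_prop
  | zero => exact continuous_zero
  | add f g _ _ hf hg => exact hf.add hg
  | smul c f _ hf => exact hf.const_smul c

theorem mul_mem_monomialSpan {f g : ℂ → ℂ} (hf : f ∈ monomialSpan) (hg : g ∈ monomialSpan) :
    f * g ∈ monomialSpan := by
  have h := Submodule.mul_mem_mul hf hg
  rw [monomialSpan, Submodule.span_mul_span] at h
  refine Submodule.span_le.mpr ?_ h
  rintro _ ⟨_, ⟨a, b, rfl⟩, _, ⟨a', b', rfl⟩, rfl⟩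
  have : (fun z : ℂ => z ^ a * conj z ^ b) * (fun z : ℂ => z ^ a' * conj z ^ b') =
      fun z => z ^ (a + a') * conj z ^ (b + b') := by
    ext z; simp only [Pi.mul_apply]; ring
  simp only [this]
  exact monomial_mem _ _

theorem conj_mem_monomialSpan {f : ℂ → ℂ} (hf : f ∈ monomialSpan) :
    (fun z => conj (f z)) ∈ monomialSpan := by
  induction hf using Submodule.span_induction with
  | mem f hf =>
    obtain ⟨a, b, rfl⟩ := hf
    convert! monomial_mem b a using 2 with z
    simp [mul_comm]
  | zero => simpa using! zero_mem _
  | add f g _ _ hf hg =>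
    convert! add_mem hf hg using 1
    ext z; simp
  | smul c f _ hf =>
    convert! Submodule.smul_mem _ (conj c) hf using 1
    ext z; simp

/-- Stone–Weierstrass on the closed disc: the star algebra generated by the identity function is
dense, and its elements are polynomials in `z` and `z̄`. -/
theorem exists_mem_monomialSpan_approx {g : ℂ → ℂ} (hg : Continuous g) {ε : ℝ} (hε : 0 < ε) :
    ∃ P ∈ monomialSpan, ∀ z ∈ disc, ‖g z - P z‖ ≤ ε := by
  let K : Set ℂ := Metric.closedBall 0 1
  have : CompactSpace K := isCompact_iff_compactSpace.mp (isCompact_closedBall 0 1)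
  have hpoly : ∀ p ∈ StarAlgebra.adjoin ℂ {ContinuousMap.restrict K (.id ℂ)},
      ∃ P ∈ monomialSpan, ∀ z : K, p z = P z := by
    intro p hp
    induction hp using StarAlgebra.adjoin_induction with
    | mem p hp =>
      obtain rfl := Set.mem_singleton_iff.mp hp
      exact ⟨_, monomial_mem 1 0, fun z => by simp⟩
    | algebraMap c => exact ⟨_, Submodule.smul_mem _ c (monomial_mem 0 0), fun z => by simp⟩
    | add p q _ _ hp hq =>
      obtain ⟨P, hP, h1⟩ := hp
      obtain ⟨Q, hQ, h2⟩ := hq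
      exact ⟨P + Q, add_mem hP hQ, fun z => by simp [h1, h2]⟩
    | mul p q _ _ hp hq =>
      obtain ⟨P, hP, h1⟩ := hp
      obtain ⟨Q, hQ, h2⟩ := hq
      exact ⟨P * Q, mul_mem_monomialSpan hP hQ, fun z => by simp [h1, h2]⟩
    | star p _ hp =>
      obtain ⟨P, hP, h1⟩ := hp
      exact ⟨_, conj_mem_monomialSpan hP, fun z => by simp [h1]⟩
  let G : C(K, ℂ) := ContinuousMap.restrict K ⟨g, hg⟩
  have hG : G ∈ StarAlgebra.elemental ℂ (ContinuousMap.restrict K (.id ℂ)) := by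
    rw [ContinuousMap.elemental_id_eq_top]
    trivial
  have hG' : G ∈ closure
      (StarAlgebra.adjoin ℂ {ContinuousMap.restrict K (.id ℂ)} : Set C(K, ℂ)) := hG
  obtain ⟨p, hp, hd⟩ := Metric.mem_closure_iff.mp hG' ε hε
  obtain ⟨P, hP, h⟩ := hpoly p hp
  refine ⟨P, hP, fun z hz => ?_⟩
  have := ContinuousMap.dist_apply_le_dist (f := G) (g := p)
    ⟨z, Metric.ball_subset_closedBall hz⟩
  rw [h, dist_eq_norm] at this
  exact this.trans hd.le

theorem integrable_mul_conj {γ : ℝ} {f g : ℂ → ℂ} (hf : Integrable f (weight γ))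
    (hg : Continuous g) : Integrable (fun z => f z * conj (g z)) (weight γ) := by
  have hcc := Complex.continuous_conj
  obtain ⟨C, hC⟩ := (isCompact_closedBall (0 : ℂ) 1).exists_bound_of_continuousOn hg.continuousOn
  refine hf.mul_bdd (c := C) (hcc.comp hg).aestronglyMeasurable ?_
  filter_upwards [ae_mem_disc γ] with z hz
  rw [RCLike.norm_conj]
  exact hC z (Metric.ball_subset_closedBall hz)

theorem integral_mul_conj_eq_zero_of_monomials {γ : ℝ} {f : ℂ → ℂ} (hf : Integrable f (weight γ))
    (h : ∀ P ∈ monomialSpan, ∫ z, f z * conj (P z) ∂weight γ = 0) {g : ℂ → ℂ}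
    (hg : Continuous g) : ∫ z, f z * conj (g z) ∂weight γ = 0 := by
  have hint {g : ℂ → ℂ} (hg : Continuous g) := integrable_mul_conj hf hg
  have key : ∀ ε > 0, ‖∫ z, f z * conj (g z) ∂weight γ‖ ≤ ε * ∫ z, ‖f z‖ ∂weight γ := by
    intro ε hε
    obtain ⟨P, hP, hPε⟩ := exists_mem_monomialSpan_approx hg hε
    rw [← sub_zero (∫ z, f z * conj (g z) ∂weight γ), ← h P hP,
      ← integral_sub (hint hg) (hint (continuous_of_mem_monomialSpan hP)), ← integral_const_mul]
    refine norm_integral_le_of_norm_le (hf.norm.const_mul ε) ?_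
    filter_upwards [ae_mem_disc γ] with z hz
    rw [← mul_sub, ← map_sub, norm_mul, RCLike.norm_conj, mul_comm]
    exact mul_le_mul_of_nonneg_right (hPε z hz) (norm_nonneg _)
  have h0 : 0 ≤ ∫ z, ‖f z‖ ∂weight γ := integral_nonneg fun _ => norm_nonneg _
  rw [← norm_le_zero_iff]
  refine le_of_forall_pos_le_add fun ε hε => ?_
  -- The `+ 1` keeps the denominator positive when `f` has vanishing `L¹` norm.
  have := key (ε / (∫ z, ‖f z‖ ∂weight γ + 1)) (by positivity)
  refine this.trans ?_
  rw [zero_add, div_mul_eq_mul_div, div_le_iff₀ (by positivity)]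
  nlinarith

/-- Triangularity: since `leadCoeff` is nonzero, `z^a z̄^N` is a combination of `R_{a,N}` and an
element of `lowSpan N`, so orthogonality passes to all monomials by induction on the degree in `z̄`.
-/
theorem integral_mul_conj_lowSpan_eq_zero {γ : ℝ} (hγ : -1 < γ) {f : L2 γ}
    (hf : ∀ m n, inner ℂ (discL2 hγ m n) f = 0) (N : ℕ) :
    ∀ P ∈ lowSpan N, ∫ z, f z * conj (P z) ∂weight γ = 0 := by
  have hlin : ∀ {S : Set (ℂ → ℂ)}, (∀ P ∈ S, Continuous P) →
      (∀ P ∈ S, ∫ z, f z * conj (P z) ∂weight γ = 0) → ∀ P ∈ Submodule.span ℂ S,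
      Continuous P ∧ ∫ z, f z * conj (P z) ∂weight γ = 0 := by
    intro S h1 h2 P hP
    induction hP using Submodule.span_induction with
    | mem P hP => exact ⟨h1 P hP, h2 P hP⟩
    | zero => exact ⟨continuous_zero, by simp⟩
    | add P Q _ _ hP hQ =>
      refine ⟨hP.1.add hQ.1, ?_⟩
      have e : ofContinuous hγ (hP.1.add hQ.1) = ofContinuous hγ hP.1 + ofContinuous hγ hQ.1 := rfl
      have := inner_ofContinuous hγ (hP.1.add hQ.1) f
      rw [e, inner_add_left, inner_ofContinuous, inner_ofContinuous, hP.2, hQ.2, add_zero] at this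
      exact this.symm
    | smul c P _ hP =>
      refine ⟨hP.1.const_smul c, ?_⟩
      have : ∀ z, f z * conj ((c • P) z) = conj c * (f z * conj (P z)) := by
        intro z; simp only [Pi.smul_apply, smul_eq_mul, map_mul]; ring
      simp_rw [this]
      rw [integral_const_mul, hP.2, mul_zero]
  have hcc := Complex.continuous_conj
  induction N with
  | zero =>
    intro P hP
    refine (hlin ?_ ?_ P hP).2
    · rintro P ⟨a, b, hb, rfl⟩; omega
    · rintro P ⟨a, b, hb, rfl⟩; omega
  | succ N ih =>
    intro P hP
    refine (hlin ?_ ?_ P hP).2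
    · rintro P ⟨a, b, hb, rfl⟩; fun_prop
    · rintro P ⟨a, b, hb, rfl⟩
      rcases Nat.lt_succ_iff_lt_or_eq.mp hb with hb | rfl
      · exact ih _ (monomial_mem_lowSpan a hb)
      · have hL : (leadCoeff γ a b : ℂ) ≠ 0 := by exact_mod_cast (leadCoeff_pos hγ a b).ne'
        have hR := hf a b
        rw [discL2, inner_ofContinuous] at hR
        have hl := discPoly_sub_leading_mem hγ a b
        have e : (fun z : ℂ => z ^ a * conj z ^ b) = (leadCoeff γ a b : ℂ)⁻¹ • (discPoly γ a b -
            (discPoly γ a b - (leadCoeff γ a b : ℂ) • fun z => z ^ a * conj z ^ b)) := by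
          rw [sub_sub_cancel, smul_smul, inv_mul_cancel₀ hL, one_smul]
        have hS : (fun z : ℂ => z ^ a * conj z ^ b) ∈ Submodule.span ℂ ({discPoly γ a b,
            discPoly γ a b - (leadCoeff γ a b : ℂ) • fun z => z ^ a * conj z ^ b} :
              Set (ℂ → ℂ)) := by
          refine Set.mem_of_eq_of_mem e (Submodule.smul_mem _ _ (sub_mem ?_ ?_))
          · exact Submodule.subset_span (Set.mem_insert _ _)
          · exact Submodule.subset_span (Set.mem_insert_of_mem _ rfl)
        refine (hlin ?_ ?_ _ hS).2
        · rintro P (rfl | rfl)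
          · exact continuous_discPoly hγ a b
          · exact continuous_of_mem_lowSpan hl
        · rintro P (rfl | rfl)
          · exact hR
          · exact ih _ hl

/-- The disc polynomials are complete in `L^{2,γ}`. -/
theorem eq_zero_of_inner_discL2_eq_zero {γ : ℝ} (hγ : -1 < γ) {f : L2 γ}
    (hf : ∀ m n, inner ℂ (discL2 hγ m n) f = 0) : f = 0 := by
  have := isFiniteMeasure_weight hγ
  have h1 : ∀ P ∈ monomialSpan, ∃ N, P ∈ lowSpan N := by
    intro P hP
    induction hP using Submodule.span_induction with
    | mem P hP =>
      obtain ⟨a, b, rfl⟩ := hP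
      exact ⟨b + 1, monomial_mem_lowSpan a b.lt_succ_self⟩
    | zero => exact ⟨0, zero_mem _⟩
    | add P Q _ _ hP hQ =>
      obtain ⟨M, hM⟩ := hP
      obtain ⟨N, hN⟩ := hQ
      exact ⟨max M N, add_mem (lowSpan_mono (le_max_left _ _) hM)
        (lowSpan_mono (le_max_right _ _) hN)⟩
    | smul c P _ hP =>
      obtain ⟨M, hM⟩ := hP
      exact ⟨M, Submodule.smul_mem _ _ hM⟩
  have h2 : ∀ P ∈ monomialSpan, ∫ z, f z * conj (P z) ∂weight γ = 0 := fun P hP =>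
    let ⟨N, hN⟩ := h1 P hP
    integral_mul_conj_lowSpan_eq_zero hγ hf N P hN
  have hint : Integrable f (weight γ) := (Lp.memLp f).integrable one_le_two
  have h3 : ∀ g : L2 γ, inner ℂ g f = 0 := by
    intro g
    -- Bounded continuous functions are dense in `L²` of this finite measure, and `f` is orthogonal
    -- to them by uniform approximation.
    refine (BoundedContinuousFunction.toLp_denseRange ℂ (weight γ) ℂ
      (p := 2) (by norm_num)).induction_on g ?_ fun g => ?_
    · exact isClosed_eq (by fun_prop) continuous_const
    · have := inner_ofContinuous hγ g.continuous f
      rw [integral_mul_conj_eq_zero_of_monomials hint h2 g.continuous] at this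
      exact this
  exact inner_self_eq_zero.mp (h3 f)

/-! ### Power series on the disc and series of disc polynomials. -/

/-- Coefficient sequences of power series that converge on the unit disc. -/
def Subexponential (c : ℕ → ℂ) : Prop :=
  ∀ r : ℝ, 0 ≤ r → r < 1 → ∃ C, ∀ m, ‖c m‖ * r ^ m ≤ C

/-- The `j`-th derivative of the power series with coefficients `c`. -/
def powerSeriesDeriv (c : ℕ → ℂ) (j : ℕ) (z : ℂ) : ℂ :=
  ∑' m, c m * (m.descFactorial j * z ^ (m - j))

theorem Subexponential.summable_norm {c : ℕ → ℂ} (hc : Subexponential c) (j : ℕ) {r : ℝ}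
    (h0 : 0 ≤ r) (h1 : r < 1) : Summable fun m => ‖c m‖ * (m.descFactorial j * r ^ (m - j)) := by
  -- With `r < ρ < 1` the terms `‖c m‖ ρ^m` stay bounded, and the ratio `r/ρ < 1` supplies a
  -- geometric majorant that absorbs the falling factorial.
  obtain ⟨ρ, hrρ, hρ1⟩ := exists_between h1
  have hρ0 : 0 < ρ := h0.trans_lt hrρ
  obtain ⟨C, hC⟩ := hc ρ hρ0.le hρ1
  have hq : ‖r / ρ‖ < 1 := by
    rw [Real.norm_of_nonneg (by positivity)]
    exact (div_lt_one hρ0).mpr hrρ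
  rw [← summable_nat_add_iff j]
  have hs := (summable_descFactorial_mul_geometric_of_norm_lt_one j hq).mul_left (C / ρ ^ j)
  refine hs.of_nonneg_of_le (fun m => by positivity) fun m => ?_
  have e : r ^ m = (r / ρ) ^ m * ρ ^ (m + j) / ρ ^ j := by
    rw [div_pow, pow_add]
    field_simp
  rw [Nat.add_sub_cancel, e]
  have := mul_le_mul_of_nonneg_right (hC (m + j))
    (by positivity : 0 ≤ (m + j).descFactorial j * (r / ρ) ^ m / ρ ^ j)
  calc _ = ‖c (m + j)‖ * ρ ^ (m + j) * ((m + j).descFactorial j * (r / ρ) ^ m / ρ ^ j) := by ring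
    _ ≤ _ := this
    _ = _ := by ring

theorem Subexponential.summable {c : ℕ → ℂ} (hc : Subexponential c) (j : ℕ) {z : ℂ}
    (hz : z ∈ disc) : Summable fun m => c m * (m.descFactorial j * z ^ (m - j)) := by
  refine Summable.of_norm ?_
  simpa using hc.summable_norm j (norm_nonneg z) (mem_ball_zero_iff.mp hz)

theorem Subexponential.hasDerivAt {c : ℕ → ℂ} (hc : Subexponential c) (j : ℕ) {z : ℂ}
    (hz : z ∈ disc) :
    HasDerivAt (powerSeriesDeriv c j) (powerSeriesDeriv c (j + 1) z) z := by
  obtain ⟨r, hzr, hr1⟩ := exists_between (mem_ball_zero_iff.mp hz)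
  have hr0 : 0 < r := (norm_nonneg z).trans_lt hzr
  refine hasDerivAt_tsum_of_isPreconnected (hc.summable_norm (j + 1) hr0.le hr1)
    (Metric.isOpen_ball (x := (0 : ℂ)) (ε := r)) (convex_ball (0 : ℂ) r).isPreconnected
    (g := fun m z => c m * (m.descFactorial j * z ^ (m - j)))
    (g' := fun m z => c m * (m.descFactorial (j + 1) * z ^ (m - (j + 1))))
    (fun m y _ => ?_) (fun m y hy => ?_) (Metric.mem_ball_self hr0)
    (hc.summable j (Metric.mem_ball_self one_pos)) (mem_ball_zero_iff.mpr hzr)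
  · refine (((hasDerivAt_pow (m - j) y).const_mul (m.descFactorial j : ℂ)).const_mul
      (c m)).congr_deriv ?_
    rw [Nat.descFactorial_succ, Nat.sub_sub]
    push_cast
    ring
  · rw [mem_ball_zero_iff] at hy
    rw [norm_mul, norm_mul, norm_pow, Complex.norm_natCast]
    gcongr

/-- The operator of `discPoly_eq` does not depend on `m`, so it can be applied to the whole power
series; only finitely many convergent series are added. -/
theorem hasSum_mul_discPoly {γ : ℝ} (hγ : -1 < γ) {c : ℕ → ℂ} (hc : Subexponential c) (n : ℕ)
    {z : ℂ} (hz : z ∈ disc) :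
    HasSum (fun m => c m * discPoly γ m n z) (∑ k ∈ Finset.range (n + 1), (discCoeff γ n k : ℂ) *
      (conj z ^ (n - k) * (1 - z * conj z) ^ k * powerSeriesDeriv c k z)) := by
  have h := hasSum_sum (s := Finset.range (n + 1)) fun k _ =>
    ((hc.summable k hz).hasSum).mul_left
      ((discCoeff γ n k : ℂ) * (conj z ^ (n - k) * (1 - z * conj z) ^ k))
  convert! h using 1
  · ext m
    rw [discPoly_eq hγ, Finset.mul_sum]
    exact Finset.sum_congr rfl fun k _ => by ring
  · exact Finset.sum_congr rfl fun k _ => by rw [powerSeriesDeriv]; ring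

/-! ### Calculus of the Wirtinger derivatives. -/

theorem dzbar_mul {F G : ℂ → ℂ} {z : ℂ} (hF : DifferentiableAt ℝ F z)
    (hG : DifferentiableAt ℝ G z) :
    dzbar (fun w => F w * G w) z = dzbar F z * G z + F z * dzbar G z := by
  have := fderiv_fun_mul hF hG
  simp only [dzbar, this, _root_.add_apply, _root_.smul_apply, smul_eq_mul]
  ring

theorem dz_mul {F G : ℂ → ℂ} {z : ℂ} (hF : DifferentiableAt ℝ F z)
    (hG : DifferentiableAt ℝ G z) :
    dz (fun w => F w * G w) z = dz F z * G z + F z * dz G z := by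
  have := fderiv_fun_mul hF hG
  simp only [dz, this, _root_.add_apply, _root_.smul_apply, smul_eq_mul]
  ring

theorem dzbar_sub {F G : ℂ → ℂ} {z : ℂ} (hF : DifferentiableAt ℝ F z)
    (hG : DifferentiableAt ℝ G z) : dzbar (fun w => F w - G w) z = dzbar F z - dzbar G z := by
  have := fderiv_fun_sub hF hG
  simp only [dzbar, this, _root_.sub_apply]
  ring

theorem dzbar_sum {ι : Type*} (s : Finset ι) {F : ι → ℂ → ℂ} {z : ℂ}
    (hF : ∀ i ∈ s, DifferentiableAt ℝ (F i) z) :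
    dzbar (fun w => ∑ i ∈ s, F i w) z = ∑ i ∈ s, dzbar (F i) z := by
  have := fderiv_fun_sum hF
  simp only [dzbar, this, _root_.sum_apply, ← Finset.sum_div, Finset.mul_sum,
    ← Finset.sum_add_distrib]

theorem dz_sum {ι : Type*} (s : Finset ι) {F : ι → ℂ → ℂ} {z : ℂ}
    (hF : ∀ i ∈ s, DifferentiableAt ℝ (F i) z) :
    dz (fun w => ∑ i ∈ s, F i w) z = ∑ i ∈ s, dz (F i) z := by
  have := fderiv_fun_sum hF
  simp only [dz, this, _root_.sum_apply, ← Finset.sum_div, Finset.mul_sum,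
    ← Finset.sum_sub_distrib]

theorem dz_of_hasDerivAt {f : ℂ → ℂ} {f' z : ℂ} (h : HasDerivAt f f' z) : dz f z = f' := by
  have := (h.hasFDerivAt.restrictScalars ℝ).fderiv
  simp only [dz, this]
  simp only [ContinuousLinearMap.coe_restrictScalars', ContinuousLinearMap.toSpanSingleton_apply,
    smul_eq_mul]
  linear_combination (-(f' / 2)) * Complex.I_sq

theorem dzbar_of_differentiableAt {f : ℂ → ℂ} {z : ℂ} (h : DifferentiableAt ℂ f z) :
    dzbar f z = 0 := by
  have := (h.hasDerivAt.hasFDerivAt.restrictScalars ℝ).fderiv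
  simp only [dzbar, this]
  simp only [ContinuousLinearMap.coe_restrictScalars', ContinuousLinearMap.toSpanSingleton_apply,
    smul_eq_mul]
  linear_combination (deriv f z / 2) * Complex.I_sq

/-- The equation `∂_{z̄} f = 0` is the Cauchy–Riemann system. -/
theorem differentiableAt_of_dzbar_eq_zero {f : ℂ → ℂ} {z : ℂ} (h : DifferentiableAt ℝ f z)
    (h0 : dzbar f z = 0) : DifferentiableAt ℂ f z := by
  refine differentiableAt_complex_iff_differentiableAt_real.mpr ⟨h, ?_⟩
  simp only [dzbar] at h0
  rw [smul_eq_mul]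
  linear_combination (-2 * Complex.I) * h0 + fderiv ℝ f z Complex.I * Complex.I_sq

theorem differentiableAt_conj {z : ℂ} : DifferentiableAt ℝ (fun w : ℂ => conj w) z :=
  Complex.conjCLE.differentiableAt

theorem dzbar_conj (f : ℂ → ℂ) (z : ℂ) : dzbar (fun w => conj (f w)) z = conj (dz f z) := by
  have h : fderiv ℝ (fun w => conj (f w)) z =
      (Complex.conjCLE : ℂ →L[ℝ] ℂ).comp (fderiv ℝ f z) :=
    Complex.conjCLE.comp_fderiv
  simp only [dzbar, dz, h, map_div₀, map_ofNat]
  simp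

theorem dz_conj (f : ℂ → ℂ) (z : ℂ) : dz (fun w => conj (f w)) z = conj (dzbar f z) := by
  have h := dzbar_conj (fun w => conj (f w)) z
  simp only [Complex.conj_conj] at h
  rw [h, Complex.conj_conj]

theorem dzbar_conj_pow (j : ℕ) (z : ℂ) :
    dzbar (fun w => conj w ^ j) z = j * conj z ^ (j - 1) := by
  have h := dzbar_conj (fun w => w ^ j) z
  rw [dz_of_hasDerivAt (hasDerivAt_pow j z)] at h
  simpa using h

/-! ### Polyanalytic functions and their holomorphic components. -/

/-- Functions given on the disc by `∑_{j<n} z̄^j f_j(z)` with holomorphic components `f_j`. -/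
def HasComponents (n : ℕ) (F : ℂ → ℂ) : Prop :=
  ∃ f : ℕ → ℂ → ℂ, (∀ j, DifferentiableOn ℂ (f j) disc) ∧
    ∀ z ∈ disc, F z = ∑ j ∈ Finset.range n, conj z ^ j * f j z

theorem differentiableAt_of_mem_disc {f : ℂ → ℂ} (hf : DifferentiableOn ℂ f disc) {z : ℂ}
    (hz : z ∈ disc) : DifferentiableAt ℂ f z :=
  hf.differentiableAt (Metric.isOpen_ball.mem_nhds hz)

theorem contDiffOn_of_holomorphic {f : ℂ → ℂ} (hf : DifferentiableOn ℂ f disc) (k : ℕ) :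
    ContDiffOn ℝ k f disc :=
  (hf.contDiffOn Metric.isOpen_ball).restrict_scalars ℝ

theorem contDiff_conj_pow (j k : ℕ) : ContDiff ℝ k fun z : ℂ => conj z ^ j :=
  Complex.conjCLE.contDiff.pow j

theorem dzbar_conj_pow_mul {f : ℂ → ℂ} (hf : DifferentiableOn ℂ f disc) (j : ℕ) {z : ℂ}
    (hz : z ∈ disc) :
    dzbar (fun w => conj w ^ j * f w) z = j * conj z ^ (j - 1) * f z := by
  have h := differentiableAt_of_mem_disc hf hz
  have hj : DifferentiableAt ℝ (fun w => conj w ^ j) z := differentiableAt_conj.fun_pow j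
  rw [dzbar_mul hj (h.restrictScalars ℝ), dzbar_conj_pow,
    dzbar_of_differentiableAt h, mul_zero, add_zero]

theorem differentiableAt_conj_pow_mul {f : ℂ → ℂ} (hf : DifferentiableOn ℂ f disc) (j : ℕ) {z : ℂ}
    (hz : z ∈ disc) : DifferentiableAt ℝ (fun w => conj w ^ j * f w) z :=
  (differentiableAt_conj.fun_pow j).fun_mul ((differentiableAt_of_mem_disc hf hz).restrictScalars ℝ)

theorem dzbar_iterate_eq_zero_of_hasComponents {n : ℕ} : ∀ {F : ℂ → ℂ}, HasComponents n F →
    ∀ z ∈ disc, (dzbar^[n] F) z = 0 := by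
  induction n with
  | zero =>
    rintro F ⟨f, -, hF⟩ z hz
    simpa using hF z hz
  | succ n ih =>
    rintro F ⟨f, hf, hF⟩ z hz
    rw [Function.iterate_succ_apply]
    refine ih ⟨fun j w => (j + 1) * f (j + 1) w, fun j => (hf _).const_mul _, fun w hw => ?_⟩ z hz
    rw [dzbar_congr hF hw, dzbar_sum _ fun j _ => differentiableAt_conj_pow_mul (hf j) j hw,
      Finset.sum_range_succ', dzbar_conj_pow_mul (hf 0) 0 hw]
    simp only [Nat.cast_zero, zero_mul, add_zero]
    refine Finset.sum_congr rfl fun j _ => ?_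
    rw [dzbar_conj_pow_mul (hf (j + 1)) (j + 1) hw, Nat.add_sub_cancel]
    push_cast
    ring

theorem HasComponents.isPolyanalytic {n : ℕ} {F : ℂ → ℂ} (h : HasComponents n F) :
    IsPolyanalytic n F := by
  refine ⟨?_, dzbar_iterate_eq_zero_of_hasComponents h⟩
  obtain ⟨f, hf, hF⟩ := h
  refine ContDiffOn.congr (ContDiffOn.sum fun j _ => ?_) hF
  exact (contDiff_conj_pow j n).contDiffOn.mul (contDiffOn_of_holomorphic (hf j) n)

/-- Induction on the order: `∂_{z̄} F` decomposes as `∑ z̄^j g_j`, and `H = ∑ z̄^(j+1) g_j/(j+1)`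
has the same `∂_{z̄}` derivative. Hence `F - H` is holomorphic and serves as the component of index
`0`. -/
theorem IsPolyanalytic.hasComponents {n : ℕ} : ∀ {F : ℂ → ℂ}, IsPolyanalytic n F →
    HasComponents n F := by
  induction n with
  | zero => exact fun {F} h => ⟨fun _ _ => 0, fun _ => differentiableOn_const 0, by simpa using h.2⟩
  | succ n ih =>
    intro F hF
    obtain ⟨g, hg, hG⟩ := ih (F := dzbar F) ⟨contDiffOn_dzbar hF.1, fun z hz => by
      rw [← Function.iterate_succ_apply]; exact hF.2 z hz⟩
    have hg' : ∀ j : ℕ, DifferentiableOn ℂ (fun w => ((j : ℂ) + 1)⁻¹ * g j w) disc :=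
      fun j => (hg j).const_mul _
    let H : ℂ → ℂ := fun w => ∑ j ∈ Finset.range n, conj w ^ (j + 1) * (((j : ℂ) + 1)⁻¹ * g j w)
    have hHd : ∀ w ∈ disc, DifferentiableAt ℝ H w := fun w hw =>
      DifferentiableAt.fun_sum fun j _ => differentiableAt_conj_pow_mul (hg' j) (j + 1) hw
    have hFd : ∀ w ∈ disc, DifferentiableAt ℝ F w := fun w hw =>
      (hF.1.differentiableOn (by simp)).differentiableAt (Metric.isOpen_ball.mem_nhds hw)
    refine ⟨fun j => Nat.casesOn j (fun w => F w - H w) fun j w => ((j : ℂ) + 1)⁻¹ * g j w,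
      fun j => ?_, fun z hz => ?_⟩
    · cases j with
      | zero =>
        intro w hw
        refine (differentiableAt_of_dzbar_eq_zero ((hFd w hw).sub (hHd w hw))
          ?_).differentiableWithinAt
        change dzbar (fun w => F w - H w) w = 0
        rw [dzbar_sub (hFd w hw) (hHd w hw), hG w hw,
          dzbar_sum _ fun j _ => differentiableAt_conj_pow_mul (hg' j) (j + 1) hw, sub_eq_zero]
        refine Finset.sum_congr rfl fun j _ => ?_
        rw [dzbar_conj_pow_mul (hg' j) (j + 1) hw, Nat.add_sub_cancel]
        have : (j : ℂ) + 1 ≠ 0 := by exact_mod_cast j.succ_ne_zero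
        push_cast
        field_simp
      | succ j => exact hg' j
    · rw [Finset.sum_range_succ']
      simp only [pow_zero, one_mul]
      exact (add_sub_cancel _ _).symm

theorem HasComponents.mono {n n' : ℕ} (h : n ≤ n') {F : ℂ → ℂ} (hF : HasComponents n F) :
    HasComponents n' F := by
  obtain ⟨f, hf, hF⟩ := hF
  refine ⟨fun j => if j < n then f j else fun _ => 0, fun j => ?_, fun z hz => ?_⟩
  · dsimp only
    split_ifs
    · exact hf j
    · exact differentiableOn_const 0
  · dsimp only
    rw [hF z hz]
    refine (Finset.sum_congr rfl fun j hj => ?_).trans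
      (Finset.sum_subset (Finset.range_mono h) fun j _ hj => ?_)
    · rw [if_pos (Finset.mem_range.mp hj)]
    · rw [if_neg (fun h => hj (Finset.mem_range.mpr h)), mul_zero]

theorem HasComponents.add {n : ℕ} {F G : ℂ → ℂ} (hF : HasComponents n F)
    (hG : HasComponents n G) : HasComponents n fun z => F z + G z := by
  obtain ⟨f, hf, hF⟩ := hF
  obtain ⟨g, hg, hG⟩ := hG
  refine ⟨fun j z => f j z + g j z, fun j => (hf j).add (hg j), fun z hz => ?_⟩
  dsimp only
  rw [hF z hz, hG z hz, ← Finset.sum_add_distrib]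
  exact Finset.sum_congr rfl fun j _ => by ring

theorem HasComponents.zero (n : ℕ) : HasComponents n fun _ => 0 :=
  ⟨fun _ _ => 0, fun _ => differentiableOn_const 0, by simp⟩

theorem HasComponents.sum {ι : Type*} {n : ℕ} (s : Finset ι) {F : ι → ℂ → ℂ}
    (hF : ∀ i ∈ s, HasComponents n (F i)) : HasComponents n fun z => ∑ i ∈ s, F i z := by
  classical
  induction s using Finset.induction_on with
  | empty => simpa using HasComponents.zero n
  | insert i s hi ih =>
    simp only [Finset.sum_insert hi]
    exact (hF i (Finset.mem_insert_self _ _)).add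
      (ih fun j hj => hF j (Finset.mem_insert_of_mem hj))

theorem HasComponents.holomorphic_mul {n : ℕ} {F g : ℂ → ℂ} (hF : HasComponents n F)
    (hg : DifferentiableOn ℂ g disc) : HasComponents n fun z => g z * F z := by
  obtain ⟨f, hf, hF⟩ := hF
  refine ⟨fun j z => g z * f j z, fun j => hg.mul (hf j), fun z hz => ?_⟩
  dsimp only
  rw [hF z hz, Finset.mul_sum]
  exact Finset.sum_congr rfl fun j _ => by ring

theorem HasComponents.conj_mul {n : ℕ} {F : ℂ → ℂ} (hF : HasComponents n F) :
    HasComponents (n + 1) fun z => conj z * F z := by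
  obtain ⟨f, hf, hF⟩ := hF
  refine ⟨fun j => Nat.casesOn j (fun _ => 0) f, fun j => ?_, fun z hz => ?_⟩
  · cases j with
    | zero => exact differentiableOn_const 0
    | succ j => exact hf j
  · rw [Finset.sum_range_succ']
    change conj z * F z = ∑ k ∈ Finset.range n, conj z ^ (k + 1) * f k z + conj z ^ 0 * 0
    rw [hF z hz, Finset.mul_sum, mul_zero, add_zero]
    exact Finset.sum_congr rfl fun j _ => by ring

theorem HasComponents.one_sub_mul {n : ℕ} {F : ℂ → ℂ} (hF : HasComponents n F) :
    HasComponents (n + 1) fun z => (1 - z * conj z) * F z := by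
  have h := (hF.mono n.le_succ).add
    (hF.conj_mul.holomorphic_mul (g := fun z => -z) differentiableOn_id.neg)
  convert! h using 2 with z
  ring

theorem hasComponents_conj_pow_mul {g : ℂ → ℂ} (hg : DifferentiableOn ℂ g disc) (p k : ℕ) :
    HasComponents (p + k + 1) fun z => conj z ^ p * (1 - z * conj z) ^ k * g z := by
  induction k with
  | zero =>
    induction p with
    | zero => exact ⟨fun _ => g, fun _ => hg, by simp⟩
    | succ p ih =>
      convert! ih.conj_mul using 2 with z
      · ring
  | succ k ih =>
    convert! ih.one_sub_mul using 2 with z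
    ring

/-- A convergent series of disc polynomials with second index `n` is polyanalytic. -/
theorem hasComponents_tsum_discPoly {γ : ℝ} (hγ : -1 < γ) {c : ℕ → ℂ} (hc : Subexponential c)
    (n : ℕ) : HasComponents (n + 1) fun z => ∑' m, c m * discPoly γ m n z := by
  have h : HasComponents (n + 1) fun z => ∑ k ∈ Finset.range (n + 1), (discCoeff γ n k : ℂ) *
      (conj z ^ (n - k) * (1 - z * conj z) ^ k * powerSeriesDeriv c k z) := by
    refine HasComponents.sum _ fun k hk => ?_
    have hk : k ≤ n := Nat.lt_succ_iff.mp (Finset.mem_range.mp hk)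
    refine HasComponents.holomorphic_mul ?_ (differentiableOn_const _)
    have := hasComponents_conj_pow_mul (g := powerSeriesDeriv c k)
      (fun z hz => (hc.hasDerivAt k hz).differentiableAt.differentiableWithinAt) (n - k) k
    rwa [Nat.sub_add_cancel hk] at this
  obtain ⟨f, hf, hF⟩ := h
  exact ⟨f, hf, fun z hz => (hasSum_mul_discPoly hγ hc n hz).tsum_eq.trans (hF z hz)⟩

/-! ### Orthogonality of polyanalytic functions to higher disc polynomials. -/

theorem discPoly_rotation (γ : ℝ) (m n : ℕ) (c : Circle) (z : ℂ) :
    discPoly γ m n (c * z) = c ^ m * conj (c : ℂ) ^ n * discPoly γ m n z := by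
  have hc : (c : ℂ) * conj (c : ℂ) = 1 := by
    rw [Complex.mul_conj, Complex.normSq_eq_norm_sq, Circle.norm_coe]; simp
  have hn : ‖(c : ℂ) * z‖ = ‖z‖ := by rw [norm_mul, Circle.norm_coe, one_mul]
  have e1 : (c : ℂ) ^ m = c ^ (m - min m n) * c ^ min m n := by
    rw [← pow_add, Nat.sub_add_cancel (min_le_left _ _)]
  have e2 : conj (c : ℂ) ^ n = conj (c : ℂ) ^ (n - min m n) * conj (c : ℂ) ^ min m n := by
    rw [← pow_add, Nat.sub_add_cancel (min_le_right _ _)]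
  have e3 : (c : ℂ) ^ min m n * conj (c : ℂ) ^ min m n = 1 := by rw [← mul_pow, hc, one_pow]
  rw [e1, e2, discPoly, discPoly, hn, map_mul, mul_pow, mul_pow]
  linear_combination (-((c : ℂ) ^ (m - min m n) * conj (c : ℂ) ^ (n - min m n) *
    (z ^ (m - min m n) * conj z ^ (n - min m n) *
      (jacobiNormalized (min m n) γ |(m : ℝ) - n| (2 * ‖z‖ ^ 2 - 1) : ℝ)))) * e3

theorem setIntegral_monomial_mul_conj_discPoly {γ : ℝ} {a j m k : ℕ} (h : a + k ≠ j + m) (r : ℝ) :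
    ∫ z in Metric.ball 0 r, z ^ a * conj z ^ j * conj (discPoly γ m k z) ∂weight γ = 0 := by
  rw [← integral_indicator measurableSet_ball]
  refine integral_eq_zero_of_rotation h fun c z => ?_
  have hn : ‖(c : ℂ) * z‖ = ‖z‖ := by rw [norm_mul, Circle.norm_coe, one_mul]
  by_cases hz : z ∈ Metric.ball (0 : ℂ) r
  · have : (c : ℂ) * z ∈ Metric.ball (0 : ℂ) r := by
      rw [mem_ball_zero_iff, hn]; rwa [mem_ball_zero_iff] at hz
    rw [Set.indicator_of_mem hz, Set.indicator_of_mem this, discPoly_rotation]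
    simp only [map_mul, map_pow, Complex.conj_conj, mul_pow, pow_add]
    ring
  · have : (c : ℂ) * z ∉ Metric.ball (0 : ℂ) r := by
      rw [mem_ball_zero_iff, hn]; rwa [mem_ball_zero_iff] at hz
    rw [Set.indicator_of_notMem hz, Set.indicator_of_notMem this, mul_zero]

theorem integrableOn_ball_of_continuousOn {γ : ℝ} (hγ : -1 < γ) {f : ℂ → ℂ}
    (hf : ContinuousOn f disc) {r : ℝ} (hr : r < 1) :
    IntegrableOn f (Metric.ball 0 r) (weight γ) := by
  have := isFiniteMeasure_weight hγ
  exact ((hf.mono (Metric.closedBall_subset_ball hr)).integrableOn_compact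
    (isCompact_closedBall 0 r)).mono_set Metric.ball_subset_closedBall

/-- Only one Taylor coefficient of `g` contributes to the pairing of `z̄^j g` with a disc
polynomial over a ball centred at the origin. -/
theorem setIntegral_conj_pow_mul_holomorphic {γ : ℝ} (hγ : -1 < γ) {g : ℂ → ℂ}
    (hg : DifferentiableOn ℂ g disc) (j m k : ℕ) {r : ℝ} (h0 : 0 < r) (hr : r < 1) :
    ∫ z in Metric.ball 0 r, conj z ^ j * g z * conj (discPoly γ m k z) ∂weight γ =
      ((m + j - k).factorial : ℂ)⁻¹ * iteratedDeriv (m + j - k) g 0 *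
        ∫ z in Metric.ball 0 r, z ^ (m + j - k) * conj z ^ j * conj (discPoly γ m k z)
          ∂weight γ := by
  have := isFiniteMeasure_weight hγ
  have hcc := Complex.continuous_conj
  have hR := continuous_discPoly hγ m k
  obtain ⟨c, hc⟩ : ∃ c : ℕ → ℂ, ∀ a, c a = (a.factorial : ℂ)⁻¹ * iteratedDeriv a g 0 :=
    ⟨_, fun _ => rfl⟩
  have hsum : ∀ z ∈ disc, HasSum (fun a => c a * z ^ a) (g z) := by
    intro z hz
    convert! Complex.hasSum_taylorSeries_on_ball hg hz using 2 with a
    simp only [sub_zero, smul_eq_mul, hc]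
    ring
  have hrd : (r : ℂ) ∈ disc := by
    rw [mem_ball_zero_iff, Complex.norm_real, Real.norm_of_nonneg h0.le]; exact hr
  have hcont : Continuous fun z : ℂ => conj z ^ j * conj (discPoly γ m k z) := by fun_prop
  obtain ⟨C, hC⟩ := (isCompact_closedBall (0 : ℂ) 1).exists_bound_of_continuousOn hcont.continuousOn
  have hint : ∀ a, Integrable (fun z => c a * (z ^ a * conj z ^ j * conj (discPoly γ m k z)))
      ((weight γ).restrict (Metric.ball 0 r)) := fun a =>
    (integrable_of_continuous hγ (by fun_prop)).integrableOn
  have hbound : ∀ a, ∫ z in Metric.ball 0 r,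
      ‖c a * (z ^ a * conj z ^ j * conj (discPoly γ m k z))‖ ∂weight γ ≤
        ‖c a * (r : ℂ) ^ a‖ * (C * (weight γ).real (Metric.ball 0 r)) := by
    intro a
    refine ((setIntegral_mono_on (hint a).norm (integrable_const (‖c a * (r : ℂ) ^ a‖ * C))
      measurableSet_ball fun z hz => ?_)).trans_eq ?_
    · have hz' := mem_ball_zero_iff.mp hz
      have h1 := hC z (mem_closedBall_zero_iff.mpr (hz'.trans hr).le)
      rw [mul_assoc, ← mul_assoc, norm_mul, norm_mul (c a), norm_mul (c a), norm_pow, norm_pow,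
        Complex.norm_real, Real.norm_of_nonneg h0.le]
      gcongr
    · rw [setIntegral_const, smul_eq_mul]
      ring
  have key := hasSum_integral_of_summable_integral_norm hint
    (((hsum r hrd).summable.norm.mul_right _).of_nonneg_of_le
      (fun a => integral_nonneg fun _ => norm_nonneg _) hbound)
  have h1 : ∫ z in Metric.ball 0 r, conj z ^ j * g z * conj (discPoly γ m k z) ∂weight γ =
      ∫ z in Metric.ball 0 r, ∑' a, c a * (z ^ a * conj z ^ j * conj (discPoly γ m k z))
        ∂weight γ := by
    refine setIntegral_congr_fun measurableSet_ball fun z hz => ?_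
    have := ((hsum z (Metric.ball_subset_ball hr.le hz)).mul_right
      (conj z ^ j * conj (discPoly γ m k z))).tsum_eq
    rw [mul_comm (conj z ^ j), mul_assoc, ← this]
    exact tsum_congr fun a => by ring
  -- The only Taylor exponent of angular weight zero is `a = m + j - k`. If `m + j < k` there is
  -- none; the truncated exponent `0` then contributes a zero integral as well.
  rw [h1, ← key.tsum_eq, tsum_eq_single (m + j - k) fun a ha => ?_]
  · rw [integral_const_mul, hc]
  · rw [integral_const_mul, setIntegral_monomial_mul_conj_discPoly (by omega), mul_zero]

/-- The radii `1 - 1/(N+2)` are positive, increase to `1` and stay below it, so the balls exhaust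
the disc while holomorphic functions stay bounded on each of them. -/
theorem tendsto_setIntegral_ball {γ : ℝ} {f : ℂ → ℂ} (hf : Integrable f (weight γ)) :
    Filter.Tendsto (fun N : ℕ => ∫ z in Metric.ball 0 (1 - 1 / ((N : ℝ) + 2)), f z ∂weight γ)
      Filter.atTop (nhds (∫ z, f z ∂weight γ)) := by
  have hU : (⋃ N : ℕ, Metric.ball (0 : ℂ) (1 - 1 / ((N : ℝ) + 2))) = disc := by
    ext z
    simp only [Set.mem_iUnion, mem_ball_zero_iff]
    constructor
    · rintro ⟨N, hN⟩
      have : 0 < 1 / ((N : ℝ) + 2) := by positivity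
      linarith
    · intro hz
      obtain ⟨N, hN⟩ := exists_nat_one_div_lt (sub_pos.mpr hz)
      refine ⟨N, ?_⟩
      have : 1 / ((N : ℝ) + 2) ≤ 1 / (N + 1) := by gcongr; norm_num
      linarith
  have h := tendsto_setIntegral_of_monotone (μ := weight γ) (f := f)
    (s := fun N : ℕ => Metric.ball (0 : ℂ) (1 - 1 / ((N : ℝ) + 2)))
    (fun _ => measurableSet_ball) (fun M N hMN => Metric.ball_subset_ball (by
      have : (M : ℝ) ≤ N := by exact_mod_cast hMN
      gcongr)) hf.integrableOn
  rwa [hU, Measure.restrict_eq_self_of_ae_mem (ae_mem_disc γ)] at h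

/-- Square integrable polyanalytic functions are orthogonal to the disc polynomials of higher
second index. -/
theorem inner_discL2_eq_zero_of_hasComponents {γ : ℝ} (hγ : -1 < γ) {n k : ℕ} (hnk : n ≤ k)
    (m : ℕ) {F : ℂ → ℂ} (hF : HasComponents n F) {f : L2 γ} (hf : f =ᵐ[weight γ] F) :
    inner ℂ (discL2 hγ m k) f = 0 := by
  have := isFiniteMeasure_weight hγ
  have hcc := Complex.continuous_conj
  have hR := continuous_discPoly hγ m k
  obtain ⟨g, hg, hF⟩ := hF
  have hint : Integrable (fun z => f z * conj (discPoly γ m k z)) (weight γ) :=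
    integrable_mul_conj ((Lp.memLp f).integrable one_le_two) hR
  have h1 := tendsto_setIntegral_ball hint
  rw [discL2, inner_ofContinuous]
  refine tendsto_nhds_unique h1 ?_
  -- These coefficients do not depend on the radius. The separate terms `z̄^j g_j` need not be
  -- integrable on the disc, so the splitting is made on smaller balls, where the pairing reduces to
  -- integrals of polynomials; only these and the pairing with `f` are passed to the limit.
  let c : ℕ → ℂ := fun j => ((m + j - k).factorial : ℂ)⁻¹ * iteratedDeriv (m + j - k) (g j) 0
  have h2 : ∀ N : ℕ, ∫ z in Metric.ball 0 (1 - 1 / ((N : ℝ) + 2)),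
      f z * conj (discPoly γ m k z) ∂weight γ = ∑ j ∈ Finset.range n, c j *
        ∫ z in Metric.ball 0 (1 - 1 / ((N : ℝ) + 2)),
          z ^ (m + j - k) * conj z ^ j * conj (discPoly γ m k z) ∂weight γ := by
    intro N
    have hp : 0 < 1 / ((N : ℝ) + 2) := by positivity
    have hp' : 1 / ((N : ℝ) + 2) < 1 := by
      rw [div_lt_one (by positivity)]
      linarith [(Nat.cast_nonneg N : (0 : ℝ) ≤ N)]
    have hlt : 1 - 1 / ((N : ℝ) + 2) < 1 := by linarith
    have h3 : ∫ z in Metric.ball 0 (1 - 1 / ((N : ℝ) + 2)),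
        f z * conj (discPoly γ m k z) ∂weight γ = ∫ z in Metric.ball 0 (1 - 1 / ((N : ℝ) + 2)),
          ∑ j ∈ Finset.range n, conj z ^ j * g j z * conj (discPoly γ m k z) ∂weight γ := by
      refine integral_congr_ae (ae_restrict_of_ae ?_)
      filter_upwards [hf, ae_mem_disc γ] with z h4 h5
      rw [h4, hF z h5, Finset.sum_mul]
    rw [h3, integral_finsetSum]
    · exact Finset.sum_congr rfl fun j _ =>
        setIntegral_conj_pow_mul_holomorphic hγ (hg j) j m k (by linarith) hlt
    · intro j _
      refine integrableOn_ball_of_continuousOn hγ ?_ hlt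
      have := (hg j).continuousOn
      fun_prop
  simp_rw [h2]
  have h4 : ∑ j ∈ Finset.range n, c j *
      ∫ z, z ^ (m + j - k) * conj z ^ j * conj (discPoly γ m k z) ∂weight γ = 0 := by
    refine Finset.sum_eq_zero fun j hj => ?_
    have hj := Finset.mem_range.mp hj
    rw [integral_monomial_mul_conj_discPoly hγ _ m (by omega), if_neg (by omega), mul_zero]
  have hcont : ∀ j, Continuous fun z : ℂ =>
      z ^ (m + j - k) * conj z ^ j * conj (discPoly γ m k z) := fun j => by fun_prop
  have h5 := tendsto_finsetSum (Finset.range n) fun j _ =>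
    (tendsto_setIntegral_ball (integrable_of_continuous hγ (hcont j))).const_mul (c j)
  rwa [h4] at h5

/-! ### Growth of coefficients and pointwise sums of `L²` series. -/

theorem Subexponential.of_norm_le {c d : ℕ → ℂ} (hd : Subexponential d)
    (h : ∀ m, ‖c m‖ ≤ ‖d m‖) : Subexponential c := fun r h0 h1 =>
  let ⟨C, hC⟩ := hd r h0 h1
  ⟨C, fun m => (mul_le_mul_of_nonneg_right (h m) (pow_nonneg h0 m)).trans (hC m)⟩

theorem Subexponential.mul {c d : ℕ → ℂ} (hc : Subexponential c) (hd : Subexponential d) :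
    Subexponential fun m => c m * d m := by
  intro r h0 h1
  -- Writing `r^m = √r^m √r^m` gives each factor its own convergent radius.
  have hs : √r < 1 := by rwa [Real.sqrt_lt' one_pos, one_pow]
  obtain ⟨C, hC⟩ := hc _ (Real.sqrt_nonneg r) hs
  obtain ⟨D, hD⟩ := hd _ (Real.sqrt_nonneg r) hs
  refine ⟨C * D, fun m => ?_⟩
  have e : r ^ m = √r ^ m * √r ^ m := by rw [← mul_pow, Real.mul_self_sqrt h0]
  have h := mul_le_mul (hC m) (hD m) (by positivity)
    ((by positivity : 0 ≤ ‖c m‖ * √r ^ m).trans (hC m))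
  calc _ = ‖c m‖ * √r ^ m * (‖d m‖ * √r ^ m) := by rw [norm_mul, e]; ring
    _ ≤ _ := h

theorem Subexponential.of_bounded {c : ℕ → ℂ} {C : ℝ} (h : ∀ m, ‖c m‖ ≤ C) :
    Subexponential c := fun _ h0 h1 =>
  ⟨C, fun m => (mul_le_of_le_one_right (norm_nonneg _) (pow_le_one₀ h0 h1.le)).trans (h m)⟩

theorem Subexponential.of_summable {c : ℕ → ℂ}
    (h : ∀ r : ℝ, 0 ≤ r → r < 1 → Summable fun m => ‖c m‖ * r ^ m) : Subexponential c := by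
  intro r h0 h1
  refine ⟨∑' m, ‖c m‖ * r ^ m, fun m => ?_⟩
  exact (h r h0 h1).le_tsum m fun j _ => by positivity

theorem Subexponential.add {c d : ℕ → ℂ} (hc : Subexponential c) (hd : Subexponential d) :
    Subexponential fun m => c m + d m := by
  intro r h0 h1
  obtain ⟨C, hC⟩ := hc r h0 h1
  obtain ⟨D, hD⟩ := hd r h0 h1
  refine ⟨C + D, fun m => ?_⟩
  have := mul_le_mul_of_nonneg_right (norm_add_le (c m) (d m)) (pow_nonneg h0 m)
  linarith [hC m, hD m]

theorem Subexponential.conj {c : ℕ → ℂ} (hc : Subexponential c) :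
    Subexponential fun m => conj (c m) :=
  hc.of_norm_le fun _ => (RCLike.norm_conj _).le

theorem poch_mono {a b : ℝ} (ha : -1 < a) (hab : a ≤ b) (m : ℕ) : poch a m ≤ poch b m := by
  induction m with
  | zero => simp [poch_zero]
  | succ m ih =>
    rw [poch_succ, poch_succ]
    have : (0 : ℝ) ≤ m := m.cast_nonneg
    exact mul_le_mul ih (by linarith) (by linarith) (poch_pos (by linarith) m).le

theorem poch_natCast (K m : ℕ) : poch K m = m.factorial * (m + K).choose K := by
  have := factorial_mul_choose_add K m
  rw [← this, ← Nat.cast_add, Ring.choose_natCast, add_comm K m, ← Nat.choose_symm_add]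

/-- For a natural number `K ≥ γ` the quotient is at most `C(m+K, K)`, which grows polynomially in
`m`. -/
theorem subexponential_poch_div_factorial {γ : ℝ} (hγ : -1 < γ) :
    Subexponential fun m => ((poch γ m / m.factorial : ℝ) : ℂ) := by
  obtain ⟨K, hK⟩ := exists_nat_ge γ
  refine Subexponential.of_norm_le (d := fun m => ((m + K).choose K : ℂ)) ?_ fun m => ?_
  · refine Subexponential.of_summable fun r h0 h1 => ?_
    have := summable_choose_mul_geometric_of_norm_lt_one K
      (r := r) (by rwa [Real.norm_of_nonneg h0])
    simpa using this
  · have h1 := poch_pos hγ m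
    rw [Complex.norm_real, Complex.norm_natCast, Real.norm_of_nonneg (by positivity),
      div_le_iff₀ (by positivity), mul_comm, ← poch_natCast]
    exact poch_mono hγ hK m

theorem subexponential_inv_normSqDisc {γ : ℝ} (hγ : -1 < γ) (n : ℕ) :
    Subexponential fun m => (((normSqDisc γ m n)⁻¹ : ℝ) : ℂ) := by
  have h1 : Subexponential fun m => (m : ℂ) := Subexponential.of_summable fun r h0 h1 => by
    have := summable_pow_mul_geometric_of_norm_lt_one 1 (r := r)
      (by rwa [Real.norm_of_nonneg h0])
    simpa using this
  have h2 : Subexponential fun _ => (γ + 1 + n : ℂ) := Subexponential.of_bounded fun _ => le_rfl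
  have h3 : Subexponential fun _ => (poch γ n / (Real.pi * n.factorial) : ℂ) :=
    Subexponential.of_bounded fun _ => le_rfl
  refine (((h1.add h2).mul h3).mul (subexponential_poch_div_factorial hγ)).of_norm_le fun m => ?_
  refine le_of_eq (congrArg _ ?_)
  have h4 := (poch_pos hγ m).ne'
  have h5 := (poch_pos hγ n).ne'
  rw [normSqDisc, inv_div]
  have := Real.pi_ne_zero
  push_cast
  field_simp
  ring

/-- The normalizing factor of the disc polynomial `R_{m,n}`. -/
def normFactor (γ : ℝ) (m n : ℕ) : ℝ := (√(normSqDisc γ m n))⁻¹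

theorem normFactor_pos {γ : ℝ} (hγ : -1 < γ) (m n : ℕ) : 0 < normFactor γ m n :=
  inv_pos.mpr (Real.sqrt_pos.mpr (normSqDisc_pos hγ m n))

theorem normFactor_mul_self {γ : ℝ} (hγ : -1 < γ) (m n : ℕ) :
    normFactor γ m n * normFactor γ m n = (normSqDisc γ m n)⁻¹ := by
  rw [normFactor, ← mul_inv, Real.mul_self_sqrt (normSqDisc_pos hγ m n).le]

theorem subexponential_normFactor {γ : ℝ} (hγ : -1 < γ) (n : ℕ) :
    Subexponential fun m => (normFactor γ m n : ℂ) := by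
  have h1 : Subexponential fun _ => (1 : ℂ) := Subexponential.of_bounded fun _ => le_rfl
  refine (h1.add (subexponential_inv_normSqDisc hγ n)).of_norm_le fun m => ?_
  have h2 := normFactor_mul_self hγ m n
  have h3 := normFactor_pos hγ m n
  have h4 := normSqDisc_pos hγ m n
  have h5 := inv_pos.mpr h4
  rw [← Complex.ofReal_one, ← Complex.ofReal_add, Complex.norm_real, Complex.norm_real,
    Real.norm_of_nonneg h3.le, Real.norm_of_nonneg (by positivity), ← h2]
  -- The bound used is `x ≤ 1 + x²` with `x² = 1/normSqDisc`.
  nlinarith [sq_nonneg (normFactor γ m n - 1)]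

theorem subexponential_discPoly {γ : ℝ} (hγ : -1 < γ) (n : ℕ) {z : ℂ} (hz : z ∈ disc) :
    Subexponential fun m => discPoly γ m n z := by
  have h1 : Subexponential fun _ => (1 : ℂ) := Subexponential.of_bounded fun _ => le_rfl
  have h := (hasSum_mul_discPoly hγ h1 n hz).summable.norm
  refine Subexponential.of_bounded (C := ∑' m, ‖1 * discPoly γ m n z‖) fun m => ?_
  have := h.le_tsum m fun j _ => norm_nonneg _
  rwa [one_mul] at this

/-- Convergence in `L²` gives a subsequence of partial sums converging almost everywhere to `f`; the
same partial sums converge pointwise on the disc by growth of the coefficients, and the limits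
agree. -/
theorem ae_eq_tsum_discPoly {γ : ℝ} (hγ : -1 < γ) {x : ℕ → ℂ} (hx : Subexponential x) {n : ℕ}
    {f : L2 γ} (hf : HasSum (fun m => x m • discL2 hγ m n) f) :
    f =ᵐ[weight γ] fun z => ∑' m, x m * discPoly γ m n z := by
  have h1 := (tendstoInMeasure_of_tendsto_Lp hf.tendsto_sum_nat).exists_seq_tendsto_ae
  obtain ⟨ns, hns, h1⟩ := h1
  have h2 : ∀ᵐ z ∂weight γ, ∀ N : ℕ, (∑ m ∈ Finset.range N, x m • discL2 hγ m n : L2 γ) z =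
      ∑ m ∈ Finset.range N, x m * discPoly γ m n z := by
    rw [ae_all_iff]
    intro N
    induction N with
    | zero =>
      filter_upwards [Lp.coeFn_zero ℂ 2 (weight γ)] with z hz
      simpa using hz
    | succ N ih =>
      simp only [Finset.sum_range_succ]
      filter_upwards [ih, Lp.coeFn_add (∑ m ∈ Finset.range N, x m • discL2 hγ m n)
        (x N • discL2 hγ N n), Lp.coeFn_smul (x N) (discL2 hγ N n), coeFn_discL2 hγ N n]
        with z h1 h2 h3 h4
      rw [h2, Pi.add_apply, h1, h3, Pi.smul_apply, h4, smul_eq_mul]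
  filter_upwards [h1, h2, ae_mem_disc γ] with z h1 h2 hz
  refine tendsto_nhds_unique h1 ?_
  simp_rw [h2]
  exact (hasSum_mul_discPoly hγ hx n hz).summable.hasSum.tendsto_sum_nat.comp hns.tendsto_atTop

/-! ### The Hilbert basis and the identification of the true spaces. -/

/-- The normalized disc polynomials. -/
def discUnit {γ : ℝ} (hγ : -1 < γ) (p : ℕ × ℕ) : L2 γ :=
  (normFactor γ p.1 p.2 : ℂ) • discL2 hγ p.1 p.2

theorem orthonormal_discUnit {γ : ℝ} (hγ : -1 < γ) : Orthonormal ℂ (discUnit hγ) := by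
  rw [orthonormal_iff_ite]
  rintro ⟨m, n⟩ ⟨m', n'⟩
  rw [discUnit, discUnit, inner_smul_left, inner_smul_right, inner_discL2, Complex.conj_ofReal]
  by_cases h : m = m' ∧ n = n'
  · obtain ⟨rfl, rfl⟩ := h
    rw [if_pos ⟨rfl, rfl⟩, if_pos rfl, ← mul_assoc, ← Complex.ofReal_mul, ← Complex.ofReal_mul,
      normFactor_mul_self hγ, inv_mul_cancel₀ (normSqDisc_pos hγ m n).ne', Complex.ofReal_one]
  · rw [if_neg h, if_neg (by simpa using h), mul_zero, mul_zero]

theorem inner_discUnit_eq_zero_iff {γ : ℝ} (hγ : -1 < γ) (p : ℕ × ℕ) (f : L2 γ) :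
    inner ℂ (discUnit hγ p) f = 0 ↔ inner ℂ (discL2 hγ p.1 p.2) f = 0 := by
  have := (normFactor_pos hγ p.1 p.2).ne'
  rw [discUnit, inner_smul_left]
  simp [this]

/-- The Hilbert basis of `L^{2,γ}` formed by the normalized disc polynomials. -/
def discBasis {γ : ℝ} (hγ : -1 < γ) : HilbertBasis (ℕ × ℕ) ℂ (L2 γ) :=
  HilbertBasis.mkOfOrthogonalEqBot (orthonormal_discUnit hγ) <| by
    rw [Submodule.eq_bot_iff]
    intro f hf
    refine eq_zero_of_inner_discL2_eq_zero hγ fun m n => ?_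
    exact (inner_discUnit_eq_zero_iff hγ (m, n) f).mp
      (Submodule.inner_right_of_mem_orthogonal (Submodule.subset_span (Set.mem_range_self (m, n))) hf)

theorem discBasis_apply {γ : ℝ} (hγ : -1 < γ) (p : ℕ × ℕ) : discBasis hγ p = discUnit hγ p := by
  rw [discBasis, HilbertBasis.coe_mkOfOrthogonalEqBot]

/-- By Parseval, two elements whose supports in the disc basis are disjoint are orthogonal. -/
theorem inner_eq_zero_of_discL2 {γ : ℝ} (hγ : -1 < γ) {f g : L2 γ}
    (h : ∀ m k, inner ℂ (discL2 hγ m k) f = 0 ∨ inner ℂ (discL2 hγ m k) g = 0) :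
    inner ℂ f g = 0 := by
  rw [← (discBasis hγ).tsum_inner_mul_inner f g]
  refine (tsum_congr fun p => ?_).trans tsum_zero
  rw [discBasis_apply]
  rcases h p.1 p.2 with h | h
  · rw [← inner_conj_symm, (inner_discUnit_eq_zero_iff hγ p f).mpr h, map_zero, zero_mul]
  · rw [(inner_discUnit_eq_zero_iff hγ p g).mpr h, mul_zero]

/-- The subspace of `L^{2,γ}` orthogonal to all `R_{m,k}` with `k ≠ n`. -/
def discSpace {γ : ℝ} (hγ : -1 < γ) (n : ℕ) : Submodule ℂ (L2 γ) :=
  (Submodule.span ℂ {x | ∃ m k, k ≠ n ∧ x = discL2 hγ m k})ᗮ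

theorem mem_discSpace {γ : ℝ} (hγ : -1 < γ) {n : ℕ} {f : L2 γ} :
    f ∈ discSpace hγ n ↔ ∀ m k, k ≠ n → inner ℂ (discL2 hγ m k) f = 0 := by
  constructor
  · intro hf m k hk
    exact Submodule.inner_right_of_mem_orthogonal (Submodule.subset_span
      (s := {x | ∃ m k, k ≠ n ∧ x = discL2 hγ m k}) ⟨m, k, hk, rfl⟩) hf
  · intro h
    rw [discSpace, Submodule.mem_orthogonal]
    intro u hu
    induction hu using Submodule.span_induction with
    | mem u hu =>
      obtain ⟨m, k, hk, rfl⟩ := hu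
      exact h m k hk
    | zero => exact inner_zero_left _
    | add u v _ _ hu hv => rw [inner_add_left, hu, hv, add_zero]
    | smul c u _ hu => rw [inner_smul_left, hu, mul_zero]

theorem discL2_mem_discSpace {γ : ℝ} (hγ : -1 < γ) (m n : ℕ) : discL2 hγ m n ∈ discSpace hγ n :=
  (mem_discSpace hγ).mpr fun m' k hk => by rw [inner_discL2, if_neg (fun h => hk h.2)]

theorem isClosed_discSpace {γ : ℝ} (hγ : -1 < γ) (n : ℕ) :
    IsClosed (discSpace hγ n : Set (L2 γ)) :=
  Submodule.isClosed_orthogonal _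

instance {γ : ℝ} (hγ : -1 < γ) (n : ℕ) : CompleteSpace (discSpace hγ n) :=
  (isClosed_discSpace hγ n).completeSpace_coe

theorem subexponential_inner {γ : ℝ} (hγ : -1 < γ) (n : ℕ) (f : L2 γ) :
    Subexponential fun m => inner ℂ (discUnit hγ (m, n)) f * (normFactor γ m n : ℂ) := by
  refine Subexponential.mul (Subexponential.of_bounded (C := ‖f‖) fun m => ?_)
    (subexponential_normFactor hγ n)
  have := norm_inner_le_norm (𝕜 := ℂ) (discUnit hγ (m, n)) f
  rwa [(orthonormal_discUnit hγ).1, one_mul] at this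

/-- The expansion of an element of `discSpace` as a pointwise convergent series. -/
theorem ae_eq_expansion {γ : ℝ} (hγ : -1 < γ) {n : ℕ} {f : L2 γ} (hf : f ∈ discSpace hγ n) :
    f =ᵐ[weight γ] fun z =>
      ∑' m, inner ℂ (discUnit hγ (m, n)) f * (normFactor γ m n : ℂ) * discPoly γ m n z := by
  refine ae_eq_tsum_discPoly hγ (subexponential_inner hγ n f) ?_
  have h := (discBasis hγ).hasSum_repr f
  have hinj : Function.Injective fun m : ℕ => (m, n) := fun a b h => (Prod.ext_iff.mp h).1
  -- The double expansion reduces to the indices `(m, n)` with `n` fixed, all other coefficients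
  -- being zero.
  rw [← hinj.hasSum_iff] at h
  · convert! h using 2 with m
    simp only [Function.comp_apply]
    rw [HilbertBasis.repr_apply_apply, discBasis_apply, mul_smul]
    rfl
  · rintro ⟨m, k⟩ hmk
    have hk : k ≠ n := fun h => hmk ⟨m, by rw [h]⟩
    rw [HilbertBasis.repr_apply_apply, discBasis_apply,
      (inner_discUnit_eq_zero_iff hγ (m, k) f).mpr ((mem_discSpace hγ).mp hf m k hk), zero_smul]

theorem mem_polyBergman_iff {γ : ℝ} {n : ℕ} {f : L2 γ} :
    f ∈ polyBergman γ n ↔ ∃ F, HasComponents (n + 1) F ∧ f =ᵐ[weight γ] F :=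
  ⟨fun ⟨F, hF, h⟩ => ⟨F, hF.hasComponents, h⟩, fun ⟨F, hF, h⟩ => ⟨F, hF.isPolyanalytic, h⟩⟩

theorem polyBergman_mono (γ : ℝ) {k n : ℕ} (h : k ≤ n) : polyBergman γ k ≤ polyBergman γ n := by
  intro f hf
  obtain ⟨F, hF, hfF⟩ := mem_polyBergman_iff.mp hf
  exact mem_polyBergman_iff.mpr ⟨F, hF.mono (by omega), hfF⟩

theorem discSpace_le_polyBergman {γ : ℝ} (hγ : -1 < γ) (n : ℕ) :
    discSpace hγ n ≤ polyBergman γ n := fun f hf =>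
  mem_polyBergman_iff.mpr ⟨_, hasComponents_tsum_discPoly hγ (subexponential_inner hγ n f) n,
    ae_eq_expansion hγ hf⟩

theorem inner_discL2_of_mem_polyBergman {γ : ℝ} (hγ : -1 < γ) {n k : ℕ} (h : n < k) (m : ℕ)
    {f : L2 γ} (hf : f ∈ polyBergman γ n) : inner ℂ (discL2 hγ m k) f = 0 := by
  obtain ⟨F, hF, hfF⟩ := mem_polyBergman_iff.mp hf
  exact inner_discL2_eq_zero_of_hasComponents hγ h m hF hfF

/-- Subtracting from `f` its projections on `discSpace hγ k`, `k ≤ n`, removes its coefficients of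
second index at most `n`. Those of higher index vanish because `f` is polyanalytic of order `n + 1`,
so the remainder is zero by completeness. -/
theorem polyBergman_eq_iSup_discSpace {γ : ℝ} (hγ : -1 < γ) (n : ℕ) :
    polyBergman γ n = ⨆ k ∈ Finset.range (n + 1), discSpace hγ k := by
  refine le_antisymm (fun f hf => ?_) (iSup₂_le fun k hk =>
    (discSpace_le_polyBergman hγ k).trans
      (polyBergman_mono γ (Nat.lt_succ_iff.mp (Finset.mem_range.mp hk))))
  have key : f - ∑ k ∈ Finset.range (n + 1), (discSpace hγ k).starProjection f = 0 := by
    refine eq_zero_of_inner_discL2_eq_zero hγ fun m j => ?_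
    have h0 : ∀ k, k ≠ j → inner ℂ (discL2 hγ m j) ((discSpace hγ k).starProjection f) = 0 :=
      fun k hk => (mem_discSpace hγ).mp (Submodule.starProjection_apply_mem _ f) m j hk.symm
    rw [inner_sub_right, inner_sum]
    rcases le_or_gt j n with hj | hj
    · rw [Finset.sum_eq_single_of_mem j (Finset.mem_range.mpr (by omega)) fun k _ hk => h0 k hk,
        ← inner_sub_right]
      exact Submodule.inner_right_of_mem_orthogonal (discL2_mem_discSpace hγ m j)
        (Submodule.sub_starProjection_mem_orthogonal f)
    · rw [inner_discL2_of_mem_polyBergman hγ hj m hf, Finset.sum_eq_zero fun k hk => h0 k ?_,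
        sub_zero]
      have := Finset.mem_range.mp hk
      omega
  rw [sub_eq_zero.mp key]
  exact Submodule.sum_mem_biSup fun k _ => Submodule.starProjection_apply_mem _ f

/-- Polyanalyticity of order `n + 1` kills the coefficients of second index `k > n`, and
orthogonality to the preceding poly-Bergman space kills those with `k < n`. Conversely, elements of
that preceding space have no coefficients of index `n` or higher, so Parseval gives the
orthogonality. -/
theorem truePolyBergman_eq_discSpace {γ : ℝ} (hγ : -1 < γ) (n : ℕ) :
    truePolyBergman γ n = discSpace hγ n := by
  cases n with
  | zero =>
    refine le_antisymm (fun f hf => (mem_discSpace hγ).mpr fun m k hk => ?_)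
      (discSpace_le_polyBergman hγ 0)
    exact inner_discL2_of_mem_polyBergman hγ (Nat.pos_of_ne_zero hk) m hf
  | succ n =>
    refine le_antisymm (fun f hf => (mem_discSpace hγ).mpr fun m k hk => ?_) fun f hf =>
      ⟨discSpace_le_polyBergman hγ _ hf, (Submodule.mem_orthogonal _ _).mpr fun g hg => ?_⟩
    · rcases lt_or_gt_of_ne hk with h | h
      · exact Submodule.inner_right_of_mem_orthogonal
          (polyBergman_mono γ (Nat.lt_succ_iff.mp h)
            (discSpace_le_polyBergman hγ k (discL2_mem_discSpace hγ m k))) hf.2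
      · exact inner_discL2_of_mem_polyBergman hγ h m hf.1
    · refine inner_eq_zero_of_discL2 hγ fun m k => ?_
      by_cases hk : k = n + 1
      · exact Or.inl (inner_discL2_of_mem_polyBergman hγ (by omega) m hg)
      · exact Or.inr ((mem_discSpace hγ).mp hf m k hk)

theorem orthogonalFamily_truePolyBergman {γ : ℝ} (hγ : -1 < γ) :
    OrthogonalFamily ℂ (fun n => truePolyBergman γ n)
      (fun n => (truePolyBergman γ n).subtypeₗᵢ) := by
  intro i j hij f g
  have hf : (f : L2 γ) ∈ discSpace hγ i := truePolyBergman_eq_discSpace hγ i ▸ f.2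
  have hg : (g : L2 γ) ∈ discSpace hγ j := truePolyBergman_eq_discSpace hγ j ▸ g.2
  refine inner_eq_zero_of_discL2 hγ fun m k => ?_
  by_cases hk : k = i
  · exact Or.inr ((mem_discSpace hγ).mp hg m k (hk ▸ hij))
  · exact Or.inl ((mem_discSpace hγ).mp hf m k hk)

theorem completeSpace_truePolyBergman {γ : ℝ} (hγ : -1 < γ) (n : ℕ) :
    CompleteSpace (truePolyBergman γ n) := by
  rw [truePolyBergman_eq_discSpace hγ]
  infer_instance

theorem discL2_mem_truePolyBergman {γ : ℝ} (hγ : -1 < γ) (m n : ℕ) :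
    discL2 hγ m n ∈ truePolyBergman γ n :=
  truePolyBergman_eq_discSpace hγ n ▸ discL2_mem_discSpace hγ m n

theorem isHilbertSum_truePolyBergman {γ : ℝ} (hγ : -1 < γ) :
    IsHilbertSum ℂ (fun n => truePolyBergman γ n)
      (fun n => (truePolyBergman γ n).subtypeₗᵢ) := by
  have := completeSpace_truePolyBergman hγ
  refine IsHilbertSum.mkInternal _ (orthogonalFamily_truePolyBergman hγ) (top_le_iff.mpr ?_)
  rw [Submodule.topologicalClosure_eq_top_iff, Submodule.eq_bot_iff]
  intro f hf
  refine eq_zero_of_inner_discL2_eq_zero hγ fun m n => ?_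
  exact Submodule.inner_right_of_mem_orthogonal
    (Submodule.mem_iSup_of_mem n (discL2_mem_truePolyBergman hγ m n)) hf

theorem eq_zero_of_mem_truePolyBergman {γ : ℝ} (hγ : -1 < γ) {n : ℕ} (f : truePolyBergman γ n)
    (h : ∀ m, inner ℂ (discL2 hγ m n) (f : L2 γ) = 0) : f = 0 := by
  have hf : (f : L2 γ) ∈ discSpace hγ n := truePolyBergman_eq_discSpace hγ n ▸ f.2
  refine Subtype.ext (eq_zero_of_inner_discL2_eq_zero hγ fun m k => ?_)
  by_cases hk : k = n
  · subst hk; exact h m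
  · exact (mem_discSpace hγ).mp hf m k hk

/-- The disc polynomials `R_{m,n}`, `m ≥ 0`, as elements of the `n`-th true space. -/
def trueDisc {γ : ℝ} (hγ : -1 < γ) (n m : ℕ) : truePolyBergman γ n :=
  ⟨discL2 hγ m n, discL2_mem_truePolyBergman hγ m n⟩

theorem topologicalClosure_span_trueDisc {γ : ℝ} (hγ : -1 < γ) (n : ℕ) :
    (Submodule.span ℂ (Set.range (trueDisc hγ n))).topologicalClosure = ⊤ := by
  have := completeSpace_truePolyBergman hγ n
  rw [Submodule.topologicalClosure_eq_top_iff, Submodule.eq_bot_iff]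
  intro f hf
  refine eq_zero_of_mem_truePolyBergman hγ f fun m => ?_
  have h := Submodule.inner_right_of_mem_orthogonal
    (Submodule.subset_span (Set.mem_range_self (f := trueDisc hγ n) m)) hf
  exact h

/-- The Hilbert basis of the `n`-th true space formed by the normalized disc polynomials. -/
def trueBasis {γ : ℝ} (hγ : -1 < γ) (n : ℕ) : HilbertBasis ℕ ℂ (truePolyBergman γ n) :=
  have := completeSpace_truePolyBergman hγ n
  HilbertBasis.mkOfOrthogonalEqBot
    (v := fun m => (normFactor γ m n : ℂ) • trueDisc hγ n m)
    (by
      have h := (orthonormal_discUnit hγ).comp (fun m : ℕ => (m, n))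
        fun a b h => (Prod.ext_iff.mp h).1
      rw [orthonormal_iff_ite] at h ⊢
      exact h)
    (by
      have := completeSpace_truePolyBergman hγ n
      rw [Submodule.eq_bot_iff]
      intro f hf
      refine eq_zero_of_mem_truePolyBergman hγ f fun m => ?_
      have h := Submodule.inner_right_of_mem_orthogonal (Submodule.subset_span
        (Set.mem_range_self (f := fun m => (normFactor γ m n : ℂ) • trueDisc hγ n m) m)) hf
      exact (inner_discUnit_eq_zero_iff hγ (m, n) f).mp h)

theorem coe_trueBasis {γ : ℝ} (hγ : -1 < γ) (n m : ℕ) :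
    (trueBasis hγ n m : L2 γ) = discUnit hγ (m, n) := by
  have := completeSpace_truePolyBergman hγ n
  rw [trueBasis, HilbertBasis.coe_mkOfOrthogonalEqBot]
  rfl

/-! ### Point evaluations and the reproducing kernel as a series. -/

theorem subexponential_kernelCoeff {γ : ℝ} (hγ : -1 < γ) (n : ℕ) {w : ℂ} (hw : w ∈ disc) :
    Subexponential fun m => ((normSqDisc γ m n)⁻¹ : ℝ) * conj (discPoly γ m n w) :=
  (subexponential_inv_normSqDisc hγ n).mul (subexponential_discPoly hγ n hw).conj

/-- The sum of squares is the kernel series on the diagonal, which converges. Hence evaluation at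
`z` is bounded on the true space. -/
theorem memℓp_evalCoeff {γ : ℝ} (hγ : -1 < γ) (n : ℕ) {z : ℂ} (hz : z ∈ disc) :
    Memℓp (fun m => conj (normFactor γ m n * discPoly γ m n z)) 2 := by
  refine memℓp_gen ?_
  have h := (hasSum_mul_discPoly hγ (subexponential_kernelCoeff hγ n hz) n hz).summable.norm
  refine h.congr fun m => ?_
  have h1 := (normFactor_pos hγ m n).le
  rw [← normFactor_mul_self hγ, RCLike.norm_conj]
  simp only [norm_mul, RCLike.norm_conj, Complex.norm_real, ENNReal.toReal_ofNat, Real.rpow_two,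
    Real.norm_of_nonneg h1]
  ring

/-- The element of the `n`-th true space that represents evaluation at `z`. -/
def evalVector {γ : ℝ} (hγ : -1 < γ) (n : ℕ) (z : disc) : truePolyBergman γ n :=
  (trueBasis hγ n).repr.symm ⟨_, memℓp_evalCoeff hγ n z.2⟩

theorem inner_trueBasis_evalVector {γ : ℝ} (hγ : -1 < γ) (n m : ℕ) (z : disc) :
    inner ℂ (trueBasis hγ n m) (evalVector hγ n z) =
      conj (normFactor γ m n * discPoly γ m n z) := by
  rw [← HilbertBasis.repr_apply_apply, evalVector, LinearIsometryEquiv.apply_symm_apply]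

theorem inner_evalVector {γ : ℝ} (hγ : -1 < γ) (n : ℕ) (z : disc) (f : truePolyBergman γ n) :
    inner ℂ (evalVector hγ n z) f =
      ∑' m, inner ℂ (discUnit hγ (m, n)) (f : L2 γ) * (normFactor γ m n : ℂ) *
        discPoly γ m n z := by
  rw [← (trueBasis hγ n).tsum_inner_mul_inner]
  refine tsum_congr fun m => ?_
  rw [← inner_conj_symm, inner_trueBasis_evalVector, Complex.conj_conj, Submodule.coe_inner,
    coe_trueBasis]
  ring

/-- The function on the plane that represents an element of the `n`-th true space. -/
def expansion {γ : ℝ} (hγ : -1 < γ) (n : ℕ) (f : L2 γ) (z : ℂ) : ℂ :=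
  ∑' m, inner ℂ (discUnit hγ (m, n)) f * (normFactor γ m n : ℂ) * discPoly γ m n z

theorem ae_eq_expansion_of_mem {γ : ℝ} (hγ : -1 < γ) (n : ℕ) (f : truePolyBergman γ n) :
    (f : L2 γ) =ᵐ[weight γ] expansion hγ n f :=
  ae_eq_expansion hγ (truePolyBergman_eq_discSpace hγ n ▸ f.2)

/-- The `n`-th true space as a reproducing kernel Hilbert space. -/
@[reducible]
def trueRKHS {γ : ℝ} (hγ : -1 < γ) (n : ℕ) : RKHS ℂ (truePolyBergman γ n) disc ℂ where
  coeCLM := ContinuousLinearMap.pi fun z => innerSL ℂ (evalVector hγ n z)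
  coeCLM_injective := by
    refine (injective_iff_map_eq_zero _).mpr fun f hf => Subtype.ext ?_
    -- The class is represented by its expansion, whose value at each point of the disc is the
    -- evaluation, so vanishing evaluations force the zero class.
    rw [Submodule.coe_zero, Lp.eq_zero_iff_ae_eq_zero]
    filter_upwards [ae_eq_expansion_of_mem hγ n f, ae_mem_disc γ] with z h hz
    have h1 := congrFun hf ⟨z, hz⟩
    rw [ContinuousLinearMap.pi_apply, innerSL_apply_apply, inner_evalVector] at h1
    rw [h]
    exact h1

theorem trueRKHS_apply {γ : ℝ} (hγ : -1 < γ) (n : ℕ) (f : truePolyBergman γ n) (z : disc) :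
    (trueRKHS hγ n).coeCLM f z = inner ℂ (evalVector hγ n z) f := rfl

theorem isPolyanalyticRealization_trueRKHS {γ : ℝ} (hγ : -1 < γ) (n : ℕ) :
    IsPolyanalyticRealization γ (n + 1) (truePolyBergman γ n) (trueRKHS hγ n) := fun f =>
  ⟨expansion hγ n f,
    (hasComponents_tsum_discPoly hγ (subexponential_inner hγ n f) n).isPolyanalytic,
    ae_eq_expansion_of_mem hγ n f, fun z => inner_evalVector hγ n z f⟩

/-- The kernel function at `w` is the unique vector representing evaluation there, so it is
`evalVector`; Parseval writes the inner product of two such vectors as the series. -/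
theorem kernel_eq_tsum {γ : ℝ} (hγ : -1 < γ) {n : ℕ} [CompleteSpace (truePolyBergman γ n)]
    [R : RKHS ℂ (truePolyBergman γ n) disc ℂ]
    (hR : ∀ f z, R.coeCLM f z = inner ℂ (evalVector hγ n z) f) (z w : disc) :
    RKHS.kernel (truePolyBergman γ n) z w 1 =
      ∑' m, ((normSqDisc γ m n)⁻¹ : ℝ) * conj (discPoly γ m n w) * discPoly γ m n z := by
  have h1 : RKHS.kerFun (truePolyBergman γ n) w (1 : ℂ) = evalVector hγ n w := by
    refine ext_inner_right ℂ fun f => ?_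
    rw [RKHS.kerFun_inner, RCLike.inner_apply, map_one, mul_one]
    exact hR f w
  have h2 : RKHS.kernel (truePolyBergman γ n) z w 1 =
      inner ℂ (evalVector hγ n z) (evalVector hγ n w) := by
    rw [← RKHS.kerFun_apply, h1]
    exact hR _ z
  rw [h2, ← (trueBasis hγ n).tsum_inner_mul_inner]
  refine tsum_congr fun m => ?_
  rw [← inner_conj_symm, inner_trueBasis_evalVector, inner_trueBasis_evalVector,
    Complex.conj_conj, ← normFactor_mul_self hγ, map_mul, Complex.conj_ofReal]
  push_cast
  ring

/-! ### The Rodrigues formula. -/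

theorem dz_congr {F G : ℂ → ℂ} (h : Set.EqOn F G disc) : Set.EqOn (dz F) (dz G) disc := by
  intro z hz
  have : F =ᶠ[nhds z] G := Filter.eventuallyEq_of_mem (Metric.isOpen_ball.mem_nhds hz) h
  simp only [dz, this.fderiv_eq]

theorem dz_iterate_congr (k : ℕ) : ∀ {F G : ℂ → ℂ}, Set.EqOn F G disc →
    Set.EqOn (dz^[k] F) (dz^[k] G) disc := by
  induction k with
  | zero => intro F G h; exact h
  | succ k ih =>
    intro F G h
    simp only [Function.iterate_succ_apply]
    exact ih (dz_congr h)

theorem dzbar_iterate_conj (k : ℕ) : ∀ f : ℂ → ℂ,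
    dzbar^[k] (fun w => conj (f w)) = fun w => conj ((dz^[k] f) w) := by
  induction k with
  | zero => intro f; rfl
  | succ k ih =>
    intro f
    rw [Function.iterate_succ_apply, Function.iterate_succ_apply, ← ih]
    congr 1
    exact funext (dzbar_conj f)

/-- The Leibniz rule for iterated Wirtinger derivatives. -/
theorem dz_iterate_mul {g p : ℕ → ℂ → ℂ}
    (hg : ∀ i, ∀ z ∈ disc, DifferentiableAt ℝ (g i) z) (hg' : ∀ i, ∀ z ∈ disc,
      dz (g i) z = g (i + 1) z)
    (hp : ∀ i, ∀ z ∈ disc, DifferentiableAt ℝ (p i) z) (hp' : ∀ i, ∀ z ∈ disc,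
      dz (p i) z = p (i + 1) z) (n : ℕ) :
    Set.EqOn (dz^[n] fun w => g 0 w * p 0 w)
      (fun z => ∑ ij ∈ Finset.HasAntidiagonal.antidiagonal n, (n.choose ij.1 : ℂ) * (g ij.1 z * p ij.2 z)) disc := by
  induction n with
  | zero => intro z _; simp
  | succ n ih =>
    intro z hz
    rw [Function.iterate_succ_apply', dz_congr ih hz]
    have hd : ∀ i j, DifferentiableAt ℝ (fun w => g i w * p j w) z := fun i j =>
      (hg i z hz).fun_mul (hp j z hz)
    rw [dz_sum _ fun ij _ => (differentiableAt_const _).fun_mul (hd ij.1 ij.2)]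
    dsimp only
    rw [Finset.sum_antidiagonal_choose_succ_mul (fun i j => g i z * p j z),
      ← Finset.sum_add_distrib]
    refine Finset.sum_congr rfl fun ij hij => ?_
    rw [dz_mul (differentiableAt_const _) (hd ij.1 ij.2), dz_mul (hg _ z hz) (hp _ z hz),
      hg' _ z hz, hp' _ z hz, dz_of_hasDerivAt (hasDerivAt_const z _),
      Nat.choose_symm_of_eq_add (Finset.HasAntidiagonal.mem_antidiagonal.mp hij).symm]
    ring

theorem hasFDerivAt_one_sub_norm_sq_rpow (s : ℝ) {z : ℂ} (hz : z ∈ disc) :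
    HasFDerivAt (fun w : ℂ => (((1 - ‖w‖ ^ 2) ^ s : ℝ) : ℂ))
      (Complex.ofRealCLM.comp ((s * (1 - ‖z‖ ^ 2) ^ (s - 1)) • (-(2 • innerSL ℝ z)))) z := by
  have h := ((hasStrictFDerivAt_norm_sq z).hasFDerivAt.const_sub 1).rpow_const (p := s)
    (Or.inl (one_sub_norm_sq_pos hz).ne')
  exact Complex.ofRealCLM.hasFDerivAt.comp z h

theorem dz_one_sub_norm_sq_rpow (s : ℝ) {z : ℂ} (hz : z ∈ disc) :
    dz (fun w : ℂ => (((1 - ‖w‖ ^ 2) ^ s : ℝ) : ℂ)) z =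
      s * (-conj z) * (((1 - ‖z‖ ^ 2) ^ (s - 1) : ℝ) : ℂ) := by
  rw [dz, (hasFDerivAt_one_sub_norm_sq_rpow s hz).fderiv]
  have h1 : inner ℝ z 1 = z.re := by simp [Complex.inner]
  have h2 : inner ℝ z Complex.I = z.im := by simp [Complex.inner]
  simp only [ContinuousLinearMap.comp_apply, _root_.smul_apply, _root_.neg_apply,
    innerSL_apply_apply, h1, h2, Complex.ofRealCLM_apply, smul_eq_mul, nsmul_eq_mul]
  have h3 : conj z = z.re - z.im * Complex.I := by
    apply Complex.ext <;> simp
  rw [h3]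
  push_cast
  ring

/-- The iterated `∂_z` derivatives of `(1 - |z|²)^a`. -/
def weightDeriv (a : ℝ) (i : ℕ) (z : ℂ) : ℂ :=
  ((∏ l ∈ Finset.range i, (a - l) : ℝ) : ℂ) * (-conj z) ^ i * (((1 - ‖z‖ ^ 2) ^ (a - i) : ℝ) : ℂ)

theorem differentiableAt_neg_conj_pow (c : ℂ) (i : ℕ) (z : ℂ) :
    DifferentiableAt ℝ (fun w : ℂ => c * (-conj w) ^ i) z :=
  (differentiableAt_const c).fun_mul (differentiableAt_conj.fun_neg.fun_pow i)

theorem differentiableAt_weightDeriv (a : ℝ) (i : ℕ) {z : ℂ} (hz : z ∈ disc) :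
    DifferentiableAt ℝ (weightDeriv a i) z :=
  (differentiableAt_neg_conj_pow _ i z).fun_mul
    (hasFDerivAt_one_sub_norm_sq_rpow (a - i) hz).differentiableAt

theorem dz_weightDeriv (a : ℝ) (i : ℕ) {z : ℂ} (hz : z ∈ disc) :
    dz (weightDeriv a i) z = weightDeriv a (i + 1) z := by
  -- The factor `c (-z̄)^i` is antiholomorphic, so `∂_z` acts only on the power of `1 - |z|²`.
  have h0 : ∀ c : ℂ, dz (fun w => c * (-conj w) ^ i) z = 0 := by
    intro c
    have h := dz_conj (fun w => conj c * (-w) ^ i) z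
    have hd : DifferentiableAt ℂ (fun w => conj c * (-w) ^ i) z := by fun_prop
    rw [dzbar_of_differentiableAt hd, map_zero] at h
    simpa using h
  have e : weightDeriv a i = fun w => (((∏ l ∈ Finset.range i, (a - l) : ℝ) : ℂ) *
    (-conj w) ^ i) * (((1 - ‖w‖ ^ 2) ^ (a - i) : ℝ) : ℂ) := rfl
  rw [e, dz_mul (differentiableAt_neg_conj_pow _ i z)
    (hasFDerivAt_one_sub_norm_sq_rpow (a - i) hz).differentiableAt, h0,
    dz_one_sub_norm_sq_rpow _ hz, weightDeriv, Finset.prod_range_succ]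
  have : a - ((i + 1 : ℕ) : ℝ) = a - i - 1 := by push_cast; ring
  rw [this]
  push_cast
  ring

theorem poch_mul_prod (γ : ℝ) {n i : ℕ} (h : i ≤ n) :
    poch γ (n - i) * ∏ l ∈ Finset.range i, (γ + n - l) = poch γ n := by
  induction i with
  | zero => simp
  | succ i ih =>
    have e : n - i = n - (i + 1) + 1 := by omega
    rw [← ih (by omega), e, poch_succ, Finset.prod_range_succ, Nat.cast_sub h]
    push_cast
    ring

/-- The Rodrigues formula, applied to a power series. -/
theorem dz_iterate_weight_mul_tsum {γ : ℝ} (hγ : -1 < γ) {c : ℕ → ℂ} (hc : Subexponential c)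
    (n : ℕ) {z : ℂ} (hz : z ∈ disc) :
    (dz^[n] fun ζ => (((1 - ‖ζ‖ ^ 2) ^ (γ + n) : ℝ) : ℂ) * ∑' m, c m * ζ ^ m) z =
      (((1 - ‖z‖ ^ 2) ^ γ * ((-1) ^ n * poch γ n) : ℝ) : ℂ) * ∑' m, c m * discPoly γ m n z := by
  have h1 : (fun ζ : ℂ => (((1 - ‖ζ‖ ^ 2) ^ (γ + n) : ℝ) : ℂ) * ∑' m, c m * ζ ^ m) =
      fun ζ => powerSeriesDeriv c 0 ζ * weightDeriv (γ + n) 0 ζ := by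
    ext ζ
    simp [powerSeriesDeriv, weightDeriv, mul_comm]
  rw [h1, dz_iterate_mul
    (fun i z hz => (hc.hasDerivAt i hz).differentiableAt.restrictScalars ℝ)
    (fun i z hz => dz_of_hasDerivAt (hc.hasDerivAt i hz))
    (fun i z hz => differentiableAt_weightDeriv _ i hz) (fun i z hz => dz_weightDeriv _ i hz) n hz]
  dsimp only
  rw [Finset.Nat.sum_antidiagonal_eq_sum_range_succ_mk, (hasSum_mul_discPoly hγ hc n hz).tsum_eq,
    Finset.mul_sum]
  -- In the Leibniz sum `k` derivatives fall on the series and `n - k` on the weight. The latter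
  -- give `(γ+n)⋯(γ+k+1) = (γ+1)_n/(γ+1)_k`, the power `(1-|z|²)^(γ+k)` and the sign `(-1)^(n-k)`,
  -- which is exactly the `k`-th term of `discPoly_eq`.
  refine Finset.sum_congr rfl fun k hk => ?_
  have hk : k ≤ n := Nat.lt_succ_iff.mp (Finset.mem_range.mp hk)
  have hu : ((1 - ‖z‖ ^ 2 : ℝ) : ℂ) = 1 - z * conj z := by
    rw [Complex.mul_conj, Complex.normSq_eq_norm_sq]; push_cast; rfl
  have e1 : γ + n - ((n - k : ℕ) : ℝ) = γ + k := by rw [Nat.cast_sub hk]; ring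
  have e2 := poch_mul_prod γ (Nat.sub_le n k)
  rw [Nat.sub_sub_self hk] at e2
  have h0 : (poch γ k : ℂ) ≠ 0 := by exact_mod_cast (poch_pos hγ k).ne'
  have e3 : (-1 : ℂ) ^ n = (-1) ^ (n - k) * (-1) ^ k := by rw [← pow_add, Nat.sub_add_cancel hk]
  have e4 : ((-1 : ℂ) ^ k) * (-1) ^ k = 1 := by rw [← mul_pow]; norm_num
  have e5 : (-conj z) ^ (n - k) = (-1) ^ (n - k) * conj z ^ (n - k) := neg_pow _ _
  dsimp only
  rw [weightDeriv, e1, Real.rpow_add_natCast (one_sub_norm_sq_pos hz).ne', discCoeff, ← e2, ← hu]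
  push_cast
  rw [e3, e5]
  field_simp
  rw [show ((-1 : ℂ) ^ k) ^ 2 = 1 by rw [sq, e4]]
  ring

/-! ### The hypergeometric series and the closed form of the kernel. -/

theorem ascPochhammer_eval_ofReal (a : ℝ) (m : ℕ) :
    (ascPochhammer ℂ m).eval ((a : ℂ) + 1) = (poch a m : ℂ) := by
  induction m with
  | zero => simp [poch_zero]
  | succ m ih =>
    rw [ascPochhammer_succ_eval, ih, poch_succ]
    push_cast
    ring

/-- The quotient `(γ+n+2)_m/(γ+n+1)_m` telescopes to `(γ+n+1+m)/(γ+n+1)`, so the `m`-th coefficient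
is a constant multiple of `(γ+1+m+n)(γ+1)_m/m!`, the dependence of `1/normSqDisc` on `m`. -/
theorem ordinaryHypergeometric_eq_tsum_normSqDisc {γ : ℝ} (hγ : -1 < γ) (n : ℕ) (x : ℂ) :
    ordinaryHypergeometric ((γ : ℂ) + n + 2) ((γ : ℂ) + 1) ((γ : ℂ) + n + 1) x =
      ((Real.pi * n.factorial / ((γ + n + 1) * poch γ n) : ℝ) : ℂ) *
        ∑' m, (((normSqDisc γ m n)⁻¹ : ℝ) : ℂ) * x ^ m := by
  rw [ordinaryHypergeometric_eq_tsum, ← tsum_mul_left]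
  refine tsum_congr fun m => ?_
  have e1 : (γ : ℂ) + n + 2 = ((γ + n + 1 : ℝ) : ℂ) + 1 := by push_cast; ring
  have e2 : (γ : ℂ) + n + 1 = ((γ + n : ℝ) : ℂ) + 1 := by push_cast; ring
  rw [e1, e2, ascPochhammer_eval_ofReal, ascPochhammer_eval_ofReal, ascPochhammer_eval_ofReal,
    smul_eq_mul, ← mul_assoc]
  congr 1
  have hn : (0 : ℝ) ≤ n := n.cast_nonneg
  have hm : (0 : ℝ) ≤ m := m.cast_nonneg
  have h1 := poch_add (γ + n) 1 m
  rw [add_comm 1 m, poch_succ, poch_succ, poch_zero, Nat.cast_zero, Nat.cast_one, add_zero,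
    one_mul] at h1
  have h2 := (poch_pos hγ n).ne'
  have h3 := (poch_pos hγ m).ne'
  have h4 := (poch_pos (γ := γ + n) (by linarith) m).ne'
  have h5 : γ + n + 1 ≠ 0 := by linarith
  have h6 : γ + 1 + m + n ≠ 0 := by linarith
  have h7 := Real.pi_ne_zero
  have key : (m.factorial : ℝ)⁻¹ * poch (γ + n + 1) m * poch γ m * (poch (γ + n) m)⁻¹ =
      Real.pi * n.factorial / ((γ + n + 1) * poch γ n) * (normSqDisc γ m n)⁻¹ := by
    rw [normSqDisc]
    field_simp
    linear_combination -h1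
  have := congrArg Complex.ofReal key
  push_cast at this ⊢
  exact this

/-- The series expansion of the closed formula for the reproducing kernel. -/
theorem kernelFormula_eq_tsum {γ : ℝ} (hγ : -1 < γ) (n : ℕ) {z w : ℂ} (hz : z ∈ disc)
    (hw : w ∈ disc) : kernelFormula γ n z w =
      ∑' m, ((normSqDisc γ m n)⁻¹ : ℝ) * conj (discPoly γ m n w) * discPoly γ m n z := by
  -- `A` is the constant relating the hypergeometric series to the norms, and `B` is the factor left
  -- by the Rodrigues formula in `w`.
  obtain ⟨A, hA⟩ : ∃ A : ℝ, A = Real.pi * n.factorial / ((γ + n + 1) * poch γ n) := ⟨_, rfl⟩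
  obtain ⟨B, hB⟩ : ∃ B : ℝ, B = (1 - ‖w‖ ^ 2) ^ γ * ((-1) ^ n * poch γ n) := ⟨_, rfl⟩
  -- For fixed `ζ` the function of `ω` is the conjugate of a weight times a power series, so the
  -- conjugated Rodrigues formula evaluates the inner derivative. The result is again a weight times
  -- a power series, now in `ζ`, ready for the second application.
  have hinner : ∀ ζ ∈ disc, (dzbar^[n] fun ω =>
      (((1 - ‖ζ‖ ^ 2) ^ (γ + n) * (1 - ‖ω‖ ^ 2) ^ (γ + n) : ℝ) : ℂ) *
        ordinaryHypergeometric ((γ : ℂ) + n + 2) ((γ : ℂ) + 1) ((γ : ℂ) + n + 1)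
          (ζ * conj ω)) w =
      (((1 - ‖ζ‖ ^ 2) ^ (γ + n) : ℝ) : ℂ) * ∑' m, ((A * B : ℝ) *
        (((normSqDisc γ m n)⁻¹ : ℝ) * conj (discPoly γ m n w))) * ζ ^ m := by
    intro ζ hζ
    let c : ℕ → ℂ := fun m => ((1 - ‖ζ‖ ^ 2) ^ (γ + n) * A : ℝ) *
      ((((normSqDisc γ m n)⁻¹ : ℝ) : ℂ) * conj ζ ^ m)
    have hpow : Subexponential fun m => conj ζ ^ m :=
      Subexponential.of_bounded (C := 1) fun m => by
        rw [norm_pow, RCLike.norm_conj]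
        exact pow_le_one₀ (norm_nonneg _) (mem_ball_zero_iff.mp hζ).le
    have hc : Subexponential c := Subexponential.mul (Subexponential.of_bounded fun _ => le_rfl)
      ((subexponential_inv_normSqDisc hγ n).mul hpow)
    have e : (fun ω => (((1 - ‖ζ‖ ^ 2) ^ (γ + n) * (1 - ‖ω‖ ^ 2) ^ (γ + n) : ℝ) : ℂ) *
        ordinaryHypergeometric ((γ : ℂ) + n + 2) ((γ : ℂ) + 1) ((γ : ℂ) + n + 1) (ζ * conj ω)) =
        fun ω => conj ((((1 - ‖ω‖ ^ 2) ^ (γ + n) : ℝ) : ℂ) * ∑' m, c m * ω ^ m) := by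
      ext ω
      rw [ordinaryHypergeometric_eq_tsum_normSqDisc hγ, ← hA, map_mul, Complex.conj_ofReal,
        Complex.conj_tsum, ← mul_assoc, ← tsum_mul_left, ← tsum_mul_left]
      refine tsum_congr fun m => ?_
      simp only [c, map_mul, map_pow, Complex.conj_conj, Complex.conj_ofReal, mul_pow]
      push_cast
      ring
    rw [e, dzbar_iterate_conj]
    dsimp only
    rw [dz_iterate_weight_mul_tsum hγ hc n hw, ← hB, map_mul, Complex.conj_ofReal,
      Complex.conj_tsum, ← tsum_mul_left, ← tsum_mul_left]
    refine tsum_congr fun m => ?_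
    simp only [c, map_mul, map_pow, Complex.conj_conj, Complex.conj_ofReal]
    push_cast
    ring
  have hd : Subexponential fun m => (A * B : ℝ) *
      (((normSqDisc γ m n)⁻¹ : ℝ) * conj (discPoly γ m n w)) :=
    Subexponential.mul (Subexponential.of_bounded fun _ => le_rfl)
      (subexponential_kernelCoeff hγ n hw)
  rw [kernelFormula, dz_iterate_congr n hinner hz, dz_iterate_weight_mul_tsum hγ hd n hz,
    ← mul_assoc, ← tsum_mul_left]
  refine tsum_congr fun m => ?_
  rw [← mul_assoc, ← mul_assoc, ← Complex.ofReal_mul, ← Complex.ofReal_mul]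
  have hn : (0 : ℝ) ≤ n := n.cast_nonneg
  -- All constants cancel: the powers of the weights, the factors of `A` and `B`, and the two signs
  -- `(-1)^n`.
  have hk : (γ + n + 1) / (Real.pi * n.factorial * (ascPochhammer ℝ n).eval (γ + 1)) *
      (1 - ‖z‖ ^ 2) ^ (-γ) * (1 - ‖w‖ ^ 2) ^ (-γ) *
      ((1 - ‖z‖ ^ 2) ^ γ * ((-1) ^ n * poch γ n)) * (A * B) = 1 := by
    have h1 := (Real.rpow_pos_of_pos (one_sub_norm_sq_pos hz) γ).ne'
    have h2 := (Real.rpow_pos_of_pos (one_sub_norm_sq_pos hw) γ).ne'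
    have h3 := (poch_pos hγ n).ne'
    have h4 : γ + n + 1 ≠ 0 := by linarith
    have h5 := Real.pi_ne_zero
    have h6 : ((-1 : ℝ) ^ n) ^ 2 = 1 := by rw [← pow_mul, mul_comm, pow_mul]; norm_num
    rw [Real.rpow_neg (one_sub_norm_sq_pos hz).le, Real.rpow_neg (one_sub_norm_sq_pos hw).le,
      hA, hB, ← poch]
    field_simp
    exact h6
  rw [hk, Complex.ofReal_one, one_mul, mul_assoc]
end PolyBergman

end

theorem theorem2 (γ : ℝ) (hγ : -1 < γ) :
    -- (i) the disc polynomials `R_{m,n}`, `m ≥ 0`, are an orthogonal basis of the true space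
    (∀ n : ℕ, ∃ e : ℕ → PolyBergman.truePolyBergman γ n,
      (∀ m, (e m : PolyBergman.L2 γ) =ᵐ[PolyBergman.weight γ] PolyBergman.discPoly γ m n) ∧
      (∀ m, e m ≠ 0) ∧
      (∀ m m', m ≠ m' → inner ℂ (e m) (e m') = 0) ∧
      (Submodule.span ℂ (Set.range e)).topologicalClosure = ⊤) ∧
    -- (ii) mutual orthogonality and the two orthogonal direct sum decompositions
    OrthogonalFamily ℂ (fun n => PolyBergman.truePolyBergman γ n)
      (fun n => (PolyBergman.truePolyBergman γ n).subtypeₗᵢ) ∧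
    IsHilbertSum ℂ (fun n => PolyBergman.truePolyBergman γ n)
      (fun n => (PolyBergman.truePolyBergman γ n).subtypeₗᵢ) ∧
    (∀ n : ℕ, PolyBergman.polyBergman γ n =
      ⨆ k ∈ Finset.range (n + 1), PolyBergman.truePolyBergman γ k) ∧
    -- (ii) each true space is a reproducing kernel Hilbert space of polyanalytic functions,
    -- and (iii) its reproducing kernel is given by the closed formula
    (∀ n : ℕ, ∃ (_ : CompleteSpace (PolyBergman.truePolyBergman γ n))
      (R : RKHS ℂ (PolyBergman.truePolyBergman γ n) PolyBergman.disc ℂ),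
      PolyBergman.IsPolyanalyticRealization γ (n + 1) (PolyBergman.truePolyBergman γ n) R ∧
      ∀ z w : PolyBergman.disc,
        RKHS.kernel (PolyBergman.truePolyBergman γ n) z w 1 =
          PolyBergman.kernelFormula γ n z w) := by
  refine ⟨fun n => ⟨PolyBergman.trueDisc hγ n, fun m => PolyBergman.coeFn_discL2 hγ m n, fun m h => ?_,
      fun m m' h => ?_, PolyBergman.topologicalClosure_span_trueDisc hγ n⟩,
    PolyBergman.orthogonalFamily_truePolyBergman hγ, PolyBergman.isHilbertSum_truePolyBergman hγ,
    fun n => ?_, fun n => ?_⟩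
  · have h1 := PolyBergman.inner_discL2 hγ m n m n
    rw [show PolyBergman.discL2 hγ m n = 0 from congrArg Subtype.val h, inner_zero_left,
      if_pos ⟨rfl, rfl⟩] at h1
    exact (PolyBergman.normSqDisc_pos hγ m n).ne (by exact_mod_cast h1)
  · exact (PolyBergman.inner_discL2 hγ m n m' n).trans (if_neg fun hh => h hh.1)
  · rw [PolyBergman.polyBergman_eq_iSup_discSpace hγ]
    simp_rw [PolyBergman.truePolyBergman_eq_discSpace hγ]
  · have hC := PolyBergman.completeSpace_truePolyBergman hγ n
    have hR := PolyBergman.trueRKHS_apply hγ n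
    refine ⟨hC, PolyBergman.trueRKHS hγ n, PolyBergman.isPolyanalyticRealization_trueRKHS hγ n,
      fun z w => ?_⟩
    rw [PolyBergman.kernelFormula_eq_tsum hγ n z.2 w.2]
    exact PolyBergman.kernel_eq_tsum (R := PolyBergman.trueRKHS hγ n) hγ hR z w
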